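/- **Setting.** Let $(\Omega,\mathcal F)$ be a measurable space and let $\mathcal H$ be a set of real random variables on it which contains the indicator $I_A$ of every $A\in\mathcal F$ and satisfies $\varphi(X_1,\dots,X_n)\in\mathcal H$ whenever $X_1,\dots,X_n\in\mathcal H$ and $|\varphi(x)-\varphi(y)|\le C(1+|x|^m+|y|^m)|x-y|$ on $\mathbb R^n$ for some $C>0$, $m\in\mathbb N$. A sublinear expectation is a functional $\mathbb E:\mathcal H\to[-\infty,\infty]$ such that for $X,Y\in\mathcal H$: $\mathbb E[X]\ge\mathbb E[Y]$ if $X\ge Y$; $\mathbb E[c]=c$ for $c\in\mathbb R$; $\mathbb E[\lambda X]=\lambda\mathbb E[X]$ for $\lambda\ge0$ (with $0\cdot(\pm\infty)=0$); $\mathbb E[X+Y]\le\mathbb E[X]+\mathbb E[Y]$ unless the right side has the form $\infty-\infty$ or $-\infty+\infty$. Assume $\mathbb E$ is countably sub-additive: $\mathbb E[X]\le\sum_{n\ge1}\mathbb E[Y_n]$ whenever $0\le X\le\sum_{n\ge1}Y_n$, $Y_n\ge0$, $X,Y_n\in\mathcal H$. Put $\mathbb V(A)=\inf\{\mathbb E[\xi]:I_A\le\xi,\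 \xi\in\mathcal H\}$ for $A\in\mathcal F$ and $$C_{\mathbb V}(X)=\int_0^\infty\mathbb V(X>x)\,dx+\int_{-\infty}^0\bigl(\mathbb V(X>x)-1\bigr)\,dx .$$ $Y\in\mathcal H$ is *independent* of $\mathbf X=(X_1,\dots,X_m)$, $X_i\in\mathcal H$, if for every Borel $\psi$ on $\mathbb R^m\times\mathbb R$ with $\psi(\mathbf X,Y)\in\mathcal H$ and $\psi(\mathbf x,Y)\in\mathcal H$ for all $\mathbf x$, one has $\mathbb E[\psi(\mathbf X,Y)]=\mathbb E\bigl[\mathbb E[\psi(\mathbf x,Y)]|_{\mathbf x=\mathbf X}\bigr]$ whenever $\bar\psi(\mathbf x):=\mathbb E[|\psi(\mathbf x,Y)|]<\infty$ for all $\mathbf x$, the variables $\bar\psi(\mathbf X)$ and $\mathbb E[\psi(\mathbf x,Y)]|_{\mathbf x=\mathbf X}$ lie in $\mathcal H$, and $\mathbb E[|\bar\psi(\mathbf X)|]<\infty$. A sequence $X_0,X_1,\dots$ in $\mathcal H$ is *independent* if $X_{n+1}$ is independent of $(X_0,\dots,X_n)$ for every $n\ge0$. $X,Y\in\mathcal H$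 are *identically distributed* if $\mathbb E[\psi(X)]=\mathbb E[\psi(Y)]$ for every Borel $\psi$ such that $\psi(X),\psi(Y)\in\mathcal H$ and both expectations are finite. For real $\alpha$ let $A_n^{\alpha}=(\alpha+1)(\alpha+2)\cdots(\alpha+n)/n!$ for $n\ge1$ (only indices $n\ge1$ are used below). **Corollary 3.1.** Let $\{X_n,n\ge0\}\subset\mathcal H$ be independent, each identically distributed as $X\in\mathcal H$, with $\mathbb E[X_i]=-\mathbb E[-X_i]=0$ for $i\ge1$. Let $r>1$, $p>\frac12$, $0<\alpha\le1$. The following are equivalent: (i) $$\begin{cases}C_{\mathbb V}\bigl(|X|^{(r-1)/(p\alpha)}\bigr)<\infty,&\text{if }0<\alpha<1-1/r,\\ C_{\mathbb V}\bigl(|X|^{r/p}\ln(1+|X|)\bigr)<\infty,&\text{if }\alpha=1-1/r,\\ C_{\mathbb V}\bigl(|X|^{r/p}\bigr)<\infty,&\text{if }1-1/r<\alpha\le1;\end{cases}$$ (ii) $$\sum_{n=1}^\infty n^{r-2}\,\mathbb V\Bigl(\max_{0\le j\le n-1}\Bigl|\sum_{i=0}^{j}\bigl(A_{n-i}^{\alpha-1}\bigr)^pX_i\Bigr|>\epsilon\,(A_n^{\alpha})^p\Bigr)<\infty\quad\text{for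 all }\epsilon>0 .$$ -/

import Mathlib

open scoped ENNReal

/-- Membership of `φ` in `C_{l,Lip}(ℝⁿ)`: local Lipschitz continuity with polynomial growth.
All norms on `ℝⁿ` give the same class; the norm used here is the sup norm of `Fin n → ℝ`. -/
def IsLocLip {n : ℕ} (φ : (Fin n → ℝ) → ℝ) : Prop :=
  ∃ C : ℝ, 0 < C ∧ ∃ m : ℕ, ∀ x y : Fin n → ℝ,
    |φ x - φ y| ≤ C * (1 + ‖x‖ ^ m + ‖y‖ ^ m) * ‖x - y‖

/-- A sublinear expectation space `(Ω, H, E)` over the measurable space `Ω`. The functional `E`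
takes values in `[-∞, ∞]`; only its values on `H` are meaningful, and only these are constrained
or used. -/
structure SublinearExpectationSpace (Ω : Type*) [MeasurableSpace Ω] where
  /-- The space of random variables. -/
  H : Set (Ω → ℝ)
  /-- The sublinear expectation. -/
  E : (Ω → ℝ) → EReal
  measurable_of_mem : ∀ X ∈ H, Measurable X
  indicator_mem : ∀ A : Set Ω, MeasurableSet A → A.indicator (fun _ => (1 : ℝ)) ∈ H
  comp_mem : ∀ (n : ℕ) (X : Fin n → Ω → ℝ), (∀ i, X i ∈ H) →
    ∀ φ : (Fin n → ℝ) → ℝ, IsLocLip φ → (fun ω => φ (fun i => X i ω)) ∈ H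
  mono : ∀ X ∈ H, ∀ Y ∈ H, (∀ ω, Y ω ≤ X ω) → E Y ≤ E X
  const : ∀ c : ℝ, E (fun _ => c) = (c : EReal)
  pos_homog : ∀ X ∈ H, ∀ c : ℝ, 0 ≤ c → E (fun ω => c * X ω) = (c : EReal) * E X
  subadd : ∀ X ∈ H, ∀ Y ∈ H, ¬ (E X = ⊤ ∧ E Y = ⊥) → ¬ (E X = ⊥ ∧ E Y = ⊤) →
    E (fun ω => X ω + Y ω) ≤ E X + E Y

namespace SublinearExpectationSpace

variable {Ω : Type*} [MeasurableSpace Ω] (S : SublinearExpectationSpace Ω)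

/-- Countable sub-additivity: `E X ≤ ∑ E (Y n)` whenever `X ≤ ∑ Y n` with nonnegative
`X, Y n ∈ H`. All quantities are nonnegative, so both series are read in `[0, ∞]`. -/
def CountablySubadditive : Prop :=
  ∀ X ∈ S.H, ∀ Y : ℕ → Ω → ℝ, (∀ n, Y n ∈ S.H) → (∀ ω, 0 ≤ X ω) → (∀ n ω, 0 ≤ Y n ω) →
    (∀ ω, ENNReal.ofReal (X ω) ≤ ∑' n, ENNReal.ofReal (Y n ω)) →
    (S.E X).toENNReal ≤ ∑' n, (S.E (Y n)).toENNReal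

/-- The capacity `V(A) = inf {E ξ : 1_A ≤ ξ, ξ ∈ H}`. The infimum lies in `[0, 1]`, since
`E ξ ≥ E 0 = 0` for each such `ξ` and `ξ = 1` is admissible. -/
noncomputable def capacity (A : Set Ω) : ℝ≥0∞ :=
  (sInf {y : EReal | ∃ ξ ∈ S.H, (∀ ω, A.indicator (fun _ => (1 : ℝ)) ω ≤ ξ ω) ∧
    S.E ξ = y}).toENNReal

/-- The Choquet expectation `∫₀^∞ V(X > x) dx + ∫_{-∞}^0 (V(X > x) - 1) dx`. As `V ≤ 1`, the
second integral is minus the integral of the nonnegative function `1 - V(X > x)`. -/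
noncomputable def choquet (X : Ω → ℝ) : EReal :=
  ((∫⁻ x in Set.Ioi (0 : ℝ), S.capacity {ω | x < X ω} : ℝ≥0∞) : EReal) -
    ((∫⁻ x in Set.Iio (0 : ℝ), (1 - S.capacity {ω | x < X ω}) : ℝ≥0∞) : EReal)

/-- `Y` is independent of the random vector `X = (X₁, …, X_m)`: for Borel `ψ` with
`ψ(X, Y) ∈ H` and `ψ(x, Y) ∈ H` for each `x`, one has `E[ψ(X, Y)] = E[E[ψ(x, Y)]|_{x = X}]`
whenever `ψ̄(x) = E|ψ(x, Y)|` is finite for each `x` and `E[|ψ̄(X)|] < ∞`. The random variables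
`ψ̄(X)` and `E[ψ(x, Y)]|_{x = X}` have to belong to `H` for these expressions to make sense.
Finiteness of `ψ̄(x)` makes `E[ψ(x, Y)]` finite, so `toReal` loses nothing. -/
def IndepOf {m : ℕ} (Y : Ω → ℝ) (X : Fin m → Ω → ℝ) : Prop :=
  ∀ ψ : (Fin m → ℝ) × ℝ → ℝ, Measurable ψ →
    (fun ω => ψ (fun i => X i ω, Y ω)) ∈ S.H →
    (∀ x : Fin m → ℝ, (fun ω => ψ (x, Y ω)) ∈ S.H) →
    (∀ x : Fin m → ℝ, S.E (fun ω => |ψ (x, Y ω)|) < ⊤) →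
    (fun ω => (S.E (fun ω' => |ψ (fun i => X i ω, Y ω')|)).toReal) ∈ S.H →
    S.E (fun ω => |(S.E (fun ω' => |ψ (fun i => X i ω, Y ω')|)).toReal|) < ⊤ →
    (fun ω => (S.E (fun ω' => ψ (fun i => X i ω, Y ω'))).toReal) ∈ S.H →
    S.E (fun ω => ψ (fun i => X i ω, Y ω)) =
      S.E (fun ω => (S.E (fun ω' => ψ (fun i => X i ω, Y ω'))).toReal)

/-- `X₀, X₁, X₂, …` is a sequence of independent random variables: `X_{n+1}` is independent of
`(X₀, …, X_n)` for each `n`. -/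
def IndepSeq (X : ℕ → Ω → ℝ) : Prop :=
  ∀ n : ℕ, S.IndepOf (X (n + 1)) (fun i : Fin (n + 1) => X i)

/-- `X` and `Y` are identically distributed: `E[ψ(X)] = E[ψ(Y)]` for each Borel `ψ` with
`ψ(X), ψ(Y) ∈ H`, whenever these sublinear expectations are finite. -/
def IdentDistr (X Y : Ω → ℝ) : Prop :=
  ∀ ψ : ℝ → ℝ, Measurable ψ → (fun ω => ψ (X ω)) ∈ S.H → (fun ω => ψ (Y ω)) ∈ S.H →
    S.E (fun ω => ψ (X ω)) ≠ ⊤ → S.E (fun ω => ψ (X ω)) ≠ ⊥ →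
    S.E (fun ω => ψ (Y ω)) ≠ ⊤ → S.E (fun ω => ψ (Y ω)) ≠ ⊥ →
    S.E (fun ω => ψ (X ω)) = S.E (fun ω => ψ (Y ω))

end SublinearExpectationSpace

/-- Cesàro numbers `A_n^α = (α+1)(α+2)⋯(α+n)/n!` for `n ≥ 1`, with the convention `A_0^α = 0`. -/
noncomputable def cesaroNumber (α : ℝ) (n : ℕ) : ℝ :=
  if n = 0 then 0 else (∏ k ∈ Finset.range n, (α + ((k : ℝ) + 1))) / (n.factorial : ℝ)

/-!
Write `τ(n, k) = (n+1)^α (k+1)^(1-α)`. With indices shifted by one, the weight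
`(A_{n-i}^(α-1) / A_n^α)^p` of `X_i` is of the exact order `τ(n, n-i)^(-p)`, and both conditions are
equivalent to the convergence of `∑_n (n+1)^(r-2) ∑_{k ≤ n} V(|X| > c τ(n, k)^p)` for one, or every,
`c > 0`. For the Choquet integrals this is the layer cake formula applied to the weighted number of
pairs with `τ(n, k) ≤ t`, which grows like `t^((r-1)/α)`, `t^r log t` or `t^r` according to the
position of `α` relative to `1 - 1/r`. If the maximal partial sum exceeds `ε`, then either some
summand exceeds a level `δ`, which is counted by the series, or a partial sum of the summands
truncated at `δ` exceeds `ε`; by an exponential inequality the latter has upper probability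
`O(n^(-m))` for any prescribed `m` once `δ` is small. Conversely, lower probabilities of independent
events multiply, so some summand is large with upper probability at least
`min(∑_{k ≤ n} V(|X| > c τ(n, k)^p), 1) / 2`, and the minimum can be dropped because the inner sum
at most doubles when `n` does.
-/

theorem isLocLip_of_lipschitzWith {n : ℕ} {K : NNReal} {φ : (Fin n → ℝ) → ℝ}
    (hφ : LipschitzWith K φ) : IsLocLip φ := by
  refine ⟨K + 1, by positivity, 0, fun x y => ?_⟩
  calc |φ x - φ y| ≤ K * ‖x - y‖ := by
        simpa only [dist_eq_norm, Real.norm_eq_abs] using hφ.dist_le_mul x y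
    _ ≤ (K + 1) * (1 + ‖x‖ ^ 0 + ‖y‖ ^ 0) * ‖x - y‖ := by
        gcongr
        simp only [pow_zero]
        linarith [K.coe_nonneg]

theorem isLocLip_mul : IsLocLip fun x : Fin 2 → ℝ => x 0 * x 1 := by
  refine ⟨1, one_pos, 1, fun x y => ?_⟩
  have hcoord (z : Fin 2 → ℝ) (i : Fin 2) : |z i| ≤ ‖z‖ := norm_le_pi_norm z i
  calc |x 0 * x 1 - y 0 * y 1| = |x 0 * (x - y) 1 + (x - y) 0 * y 1| := by
        simp only [Pi.sub_apply]; ring_nf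
    _ ≤ |x 0| * |(x - y) 1| + |(x - y) 0| * |y 1| := by
        simpa only [abs_mul] using abs_add_le (x 0 * (x - y) 1) ((x - y) 0 * y 1)
    _ ≤ ‖x‖ * ‖x - y‖ + ‖x - y‖ * ‖y‖ := by gcongr <;> exact hcoord _ _
    _ ≤ 1 * (1 + ‖x‖ ^ 1 + ‖y‖ ^ 1) * ‖x - y‖ := by
        linear_combination norm_nonneg (x - y)

theorem indicator_one_nonneg {ι : Type*} (A : Set ι) (x : ι) :
    0 ≤ A.indicator (fun _ => (1 : ℝ)) x :=
  Set.indicator_nonneg (fun _ _ => zero_le_one) x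

theorem indicator_one_le_one {ι : Type*} (A : Set ι) (x : ι) :
    A.indicator (fun _ => (1 : ℝ)) x ≤ 1 :=
  Set.indicator_le' (fun _ _ => le_rfl) (fun _ _ => zero_le_one) x

namespace SublinearExpectationSpace

variable {Ω : Type*} [MeasurableSpace Ω] {S : SublinearExpectationSpace Ω}

section Membership

variable {X Y : Ω → ℝ}

theorem lipschitz_comp_mem {K : NNReal} {φ : ℝ → ℝ} (hφ : LipschitzWith K φ) (hX : X ∈ S.H) :
    (fun ω => φ (X ω)) ∈ S.H :=
  S.comp_mem 1 (fun _ => X) (fun _ => hX) (fun x => φ (x 0))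
    (isLocLip_of_lipschitzWith (hφ.comp (LipschitzWith.eval 0)))

theorem const_mem (S : SublinearExpectationSpace Ω) (c : ℝ) : (fun _ : Ω => c) ∈ S.H :=
  S.comp_mem 0 (fun i => i.elim0) (fun i => i.elim0) (fun _ => c)
    (isLocLip_of_lipschitzWith (LipschitzWith.const c))

theorem add_mem (hX : X ∈ S.H) (hY : Y ∈ S.H) : (fun ω => X ω + Y ω) ∈ S.H :=
  S.comp_mem 2 ![X, Y] (Fin.forall_fin_two.2 ⟨hX, hY⟩) (fun x => x 0 + x 1)
    (isLocLip_of_lipschitzWith ((LipschitzWith.eval 0).add (LipschitzWith.eval 1)))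

theorem mul_mem (hX : X ∈ S.H) (hY : Y ∈ S.H) : (fun ω => X ω * Y ω) ∈ S.H :=
  S.comp_mem 2 ![X, Y] (Fin.forall_fin_two.2 ⟨hX, hY⟩) _ isLocLip_mul

theorem const_mul_mem (c : ℝ) (hX : X ∈ S.H) : (fun ω => c * X ω) ∈ S.H :=
  mul_mem (S.const_mem c) hX

theorem abs_mem (hX : X ∈ S.H) : (fun ω => |X ω|) ∈ S.H :=
  lipschitz_comp_mem lipschitzWith_one_norm hX

theorem prod_mem {ι : Type*} (s : Finset ι) {X : ι → Ω → ℝ} (hX : ∀ i, X i ∈ S.H) :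
    (fun ω => ∏ i ∈ s, X i ω) ∈ S.H := by
  classical
  induction s using Finset.induction_on with
  | empty => simpa only [Finset.prod_empty] using S.const_mem 1
  | insert a s ha ih => simpa only [Finset.prod_insert ha] using mul_mem (hX a) ih

end Membership

section Expectation

variable {X Y : Ω → ℝ}

theorem E_le_of_forall_le (hX : X ∈ S.H) {c : ℝ} (h : ∀ ω, X ω ≤ c) : S.E X ≤ c :=
  S.const c ▸ S.mono _ (S.const_mem c) _ hX h

theorem le_E_of_forall_le (hX : X ∈ S.H) {c : ℝ} (h : ∀ ω, c ≤ X ω) : (c : EReal) ≤ S.E X :=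
  S.const c ▸ S.mono _ hX _ (S.const_mem c) h

theorem coe_toReal_E (hX : X ∈ S.H) {c : ℝ} (h : ∀ ω, |X ω| ≤ c) :
    ((S.E X).toReal : EReal) = S.E X :=
  EReal.coe_toReal
    ((E_le_of_forall_le hX fun ω => (abs_le.1 (h ω)).2).trans_lt (EReal.coe_lt_top _)).ne
    ((EReal.bot_lt_coe _).trans_le (le_E_of_forall_le hX fun ω => (abs_le.1 (h ω)).1)).ne'

theorem E_add_le (hX : X ∈ S.H) (hY : Y ∈ S.H) {a b : ℝ} (ha : S.E X ≤ a) (hb : S.E Y ≤ b) :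
    S.E (fun ω => X ω + Y ω) ≤ ((a + b : ℝ) : EReal) := by
  have hXt : S.E X ≠ ⊤ := (ha.trans_lt (EReal.coe_lt_top a)).ne
  have hYt : S.E Y ≠ ⊤ := (hb.trans_lt (EReal.coe_lt_top b)).ne
  rw [EReal.coe_add]
  exact (S.subadd X hX Y hY (fun h => hXt h.1) (fun h => hYt h.2)).trans (add_le_add ha hb)

theorem E_add_const (hX : X ∈ S.H) (c : ℝ) : S.E (fun ω => X ω + c) = S.E X + c := by
  have hle {Y : Ω → ℝ} (hY : Y ∈ S.H) (b : ℝ) : S.E (fun ω => Y ω + b) ≤ S.E Y + b := by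
    simpa only [S.const] using S.subadd Y hY _ (S.const_mem b)
      (by simp only [S.const, EReal.coe_ne_bot, and_false, not_false_eq_true])
      (by simp only [S.const, EReal.coe_ne_top, and_false, not_false_eq_true])
  refine (hle hX c).antisymm ?_
  rw [← EReal.le_sub_iff_add_le (.inl (EReal.coe_ne_bot c)) (.inl (EReal.coe_ne_top c))]
  have hneg := hle (add_mem hX (S.const_mem c)) (-c)
  simp only [add_neg_cancel_right] at hneg
  rwa [EReal.coe_neg, ← sub_eq_add_neg] at hneg

theorem E_const_mul_le (hX : X ∈ S.H) {a c : ℝ} (hc : 0 ≤ c) (ha : S.E X ≤ a) :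
    S.E (fun ω => c * X ω) ≤ ((c * a : ℝ) : EReal) := by
  rw [S.pos_homog X hX c hc, EReal.coe_mul]
  exact mul_le_mul_of_nonneg_left ha (EReal.coe_nonneg.2 hc)

end Expectation

section Capacity

variable {A B : Set Ω}

/-- The upper probability `E[1_A]` as a real number. On measurable sets it is the capacity; on
other sets it is meaningless, since `1_A` need not lie in `H`. -/
noncomputable def prob (S : SublinearExpectationSpace Ω) (A : Set Ω) : ℝ :=
  (S.E (A.indicator fun _ => (1 : ℝ))).toReal

theorem coe_prob (hA : MeasurableSet A) :
    (S.prob A : EReal) = S.E (A.indicator fun _ => (1 : ℝ)) :=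
  coe_toReal_E (S.indicator_mem A hA) (c := 1) fun ω => by
    rw [abs_of_nonneg (indicator_one_nonneg A ω)]
    exact indicator_one_le_one A ω

theorem prob_nonneg (hA : MeasurableSet A) : 0 ≤ S.prob A := by
  rw [← EReal.coe_le_coe_iff, coe_prob hA]
  exact le_E_of_forall_le (S.indicator_mem A hA) (indicator_one_nonneg A)

theorem prob_le_one (hA : MeasurableSet A) : S.prob A ≤ 1 := by
  rw [← EReal.coe_le_coe_iff, coe_prob hA]
  exact E_le_of_forall_le (S.indicator_mem A hA) (indicator_one_le_one A)

theorem capacity_eq_ofReal_prob (hA : MeasurableSet A) :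
    S.capacity A = ENNReal.ofReal (S.prob A) := by
  have hInf : sInf {y : EReal | ∃ ξ ∈ S.H, (∀ ω, A.indicator (fun _ => (1 : ℝ)) ω ≤ ξ ω) ∧
      S.E ξ = y} = S.prob A := by
    rw [coe_prob hA]
    refine le_antisymm (sInf_le ⟨_, S.indicator_mem A hA, fun _ => le_rfl, rfl⟩) (le_sInf ?_)
    rintro _ ⟨ξ, hξ, hle, rfl⟩
    exact S.mono _ hξ _ (S.indicator_mem A hA) hle
  rw [capacity, hInf, EReal.toENNReal_of_ne_top (EReal.coe_ne_top _), EReal.toReal_coe]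

theorem prob_empty : S.prob ∅ = 0 := by
  simp only [prob, Set.indicator_empty, S.const 0, EReal.toReal_coe]

theorem prob_univ : S.prob Set.univ = 1 := by
  simp only [prob, Set.indicator_univ, S.const 1, EReal.toReal_coe]

theorem prob_le_of_E_le (hA : MeasurableSet A) {ξ : Ω → ℝ} (hξ : ξ ∈ S.H) (h0 : ∀ ω, 0 ≤ ξ ω)
    (h1 : ∀ ω ∈ A, 1 ≤ ξ ω) {c : ℝ} (hc : S.E ξ ≤ c) : S.prob A ≤ c := by
  rw [← EReal.coe_le_coe_iff, coe_prob hA]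
  exact (S.mono _ hξ _ (S.indicator_mem A hA) (Set.indicator_le' h1 fun ω _ => h0 ω)).trans hc

theorem prob_mono (hA : MeasurableSet A) (hB : MeasurableSet B) (h : A ⊆ B) :
    S.prob A ≤ S.prob B :=
  prob_le_of_E_le hA (S.indicator_mem B hB) (indicator_one_nonneg B)
    (fun _ hω => (Set.indicator_of_mem (h hω) fun _ => (1 : ℝ)).ge) (coe_prob hB).ge

theorem prob_union_le (hA : MeasurableSet A) (hB : MeasurableSet B) :
    S.prob (A ∪ B) ≤ S.prob A + S.prob B := by
  refine prob_le_of_E_le (hA.union hB) (add_mem (S.indicator_mem A hA) (S.indicator_mem B hB))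
    (fun ω => add_nonneg (indicator_one_nonneg A ω) (indicator_one_nonneg B ω)) ?_
    (E_add_le (S.indicator_mem A hA) (S.indicator_mem B hB) (coe_prob hA).ge (coe_prob hB).ge)
  rintro ω (hω | hω)
  · simpa only [Set.indicator_of_mem hω, le_add_iff_nonneg_right] using indicator_one_nonneg B ω
  · simpa only [Set.indicator_of_mem hω, le_add_iff_nonneg_left] using indicator_one_nonneg A ω

theorem prob_biUnion_le {ι : Type*} (s : Finset ι) {A : ι → Set Ω}
    (hA : ∀ i, MeasurableSet (A i)) : S.prob (⋃ i ∈ s, A i) ≤ ∑ i ∈ s, S.prob (A i) := by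
  classical
  induction s using Finset.induction_on with
  | empty => simp only [Finset.notMem_empty, Set.iUnion_of_empty, Set.iUnion_empty, prob_empty,
      Finset.sum_empty, le_refl]
  | insert a s ha ih =>
    rw [Finset.sum_insert ha, Finset.set_biUnion_insert]
    exact (prob_union_le (hA a) (s.measurableSet_biUnion fun i _ => hA i)).trans (by gcongr)

theorem E_neg_indicator_compl (hA : MeasurableSet A) :
    S.E (fun ω => -1 * Aᶜ.indicator (fun _ => (1 : ℝ)) ω) = ((S.prob A - 1 : ℝ) : EReal) := by
  have hcompl (ω : Ω) : -1 * Aᶜ.indicator (fun _ => (1 : ℝ)) ω =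
      A.indicator (fun _ => (1 : ℝ)) ω + -1 := by
    rw [Set.indicator_compl, Pi.sub_apply]; ring
  simp only [hcompl]
  rw [E_add_const (S.indicator_mem A hA), ← coe_prob hA, ← EReal.coe_add, sub_eq_add_neg]

theorem prob_preimage_eq {X Y : Ω → ℝ} (hX : X ∈ S.H) (hY : Y ∈ S.H) (h : S.IdentDistr X Y)
    {B : Set ℝ} (hB : MeasurableSet B) : S.prob (X ⁻¹' B) = S.prob (Y ⁻¹' B) := by
  have hXB : MeasurableSet (X ⁻¹' B) := S.measurable_of_mem X hX hB
  have hYB : MeasurableSet (Y ⁻¹' B) := S.measurable_of_mem Y hY hB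
  have hEX : S.E (fun ω => B.indicator (fun _ => (1 : ℝ)) (X ω)) = S.prob (X ⁻¹' B) :=
    (coe_prob hXB).symm
  have hEY : S.E (fun ω => B.indicator (fun _ => (1 : ℝ)) (Y ω)) = S.prob (Y ⁻¹' B) :=
    (coe_prob hYB).symm
  have hEq := h (B.indicator fun _ => (1 : ℝ)) (measurable_const.indicator hB)
    (S.indicator_mem _ hXB) (S.indicator_mem _ hYB)
  rw [hEX, hEY] at hEq
  exact EReal.coe_injective (hEq (EReal.coe_ne_top _) (EReal.coe_ne_bot _) (EReal.coe_ne_top _)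
    (EReal.coe_ne_bot _))

end Capacity

section Independence

/-- Positive homogeneity makes the product of a nonnegative function of `X` and a function of `Y`
an admissible test function in the definition of independence. -/
theorem IndepOf.E_mul {m : ℕ} {X : Fin m → Ω → ℝ} {Y : Ω → ℝ} (h : S.IndepOf Y X)
    {f : (Fin m → ℝ) → ℝ} {g : ℝ → ℝ} (hf : Measurable f) (hg : Measurable g)
    (hf0 : ∀ x, 0 ≤ f x) {a b : ℝ} (hfa : ∀ x, f x ≤ a) (hgb : ∀ y, |g y| ≤ b)
    (hfX : (fun ω => f fun i => X i ω) ∈ S.H) (hgY : (fun ω => g (Y ω)) ∈ S.H) :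
    S.E (fun ω => f (fun i => X i ω) * g (Y ω)) =
      S.E (fun ω => (S.E fun ω' => g (Y ω')).toReal * f (fun i => X i ω)) := by
  have toReal_E_mul {Z : Ω → ℝ} (hZ : Z ∈ S.H) (x : Fin m → ℝ) :
      (S.E fun ω => f x * Z ω).toReal = (S.E Z).toReal * f x := by
    rw [S.pos_homog Z hZ _ (hf0 x), EReal.toReal_mul, EReal.toReal_coe, mul_comm]
  have habs (x : Fin m → ℝ) : (S.E fun ω => |f x * g (Y ω)|).toReal =
      (S.E fun ω => |g (Y ω)|).toReal * f x := by
    simp only [abs_mul, abs_of_nonneg (hf0 x)]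
    exact toReal_E_mul (abs_mem hgY) x
  have habs_lt (x : Fin m → ℝ) : S.E (fun ω => |f x * g (Y ω)|) < ⊤ := by
    refine (E_le_of_forall_le (abs_mem (const_mul_mem _ hgY)) (c := a * b) fun ω => ?_).trans_lt
      (EReal.coe_lt_top _)
    rw [abs_mul, abs_of_nonneg (hf0 x)]
    exact mul_le_mul (hfa x) (hgb _) (abs_nonneg _) ((hf0 x).trans (hfa x))
  have hbar_lt : S.E (fun ω => |(S.E fun ω' => |g (Y ω')|).toReal * f (fun i => X i ω)|) < ⊤ := by
    refine (E_le_of_forall_le (abs_mem (const_mul_mem _ hfX))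
      (c := |(S.E fun ω => |g (Y ω)|).toReal| * a) fun ω => ?_).trans_lt (EReal.coe_lt_top _)
    rw [abs_mul, abs_of_nonneg (hf0 _)]
    exact mul_le_mul_of_nonneg_left (hfa _) (abs_nonneg _)
  have hindep := h (fun z => f z.1 * g z.2)
    ((hf.comp measurable_fst).mul (hg.comp measurable_snd)) (mul_mem hfX hgY)
    (fun x => const_mul_mem (f x) hgY) habs_lt
  simp only [habs, toReal_E_mul hgY] at hindep
  exact hindep (const_mul_mem _ hfX) hbar_lt (const_mul_mem _ hfX)

/-- `σ = 1` multiplies upper expectations, `σ = -1` lower ones. -/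
theorem IndepSeq.E_const_mul_prod {X : ℕ → Ω → ℝ} (hind : S.IndepSeq X) {g : ℕ → ℝ → ℝ}
    (hg : ∀ i, Measurable (g i)) (hg0 : ∀ i y, 0 ≤ g i y) {b : ℝ} (hgb : ∀ i y, g i y ≤ b)
    (hgX : ∀ i, (fun ω => g i (X i ω)) ∈ S.H) {σ : ℝ} {c : ℕ → ℝ} (hc0 : ∀ i, 0 ≤ c i)
    (hc : ∀ i, S.E (fun ω => σ * g i (X i ω)) = ((σ * c i : ℝ) : EReal)) (n : ℕ) :
    S.E (fun ω => σ * ∏ i ∈ Finset.range (n + 1), g i (X i ω)) =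
      ((σ * ∏ i ∈ Finset.range (n + 1), c i : ℝ) : EReal) := by
  induction n with
  | zero => simpa only [zero_add, Finset.prod_range_one] using hc 0
  | succ n ih =>
    have hprod (ω : Ω) :
        ∏ i : Fin (n + 1), g i (X i ω) = ∏ i ∈ Finset.range (n + 1), g i (X i ω) :=
      Fin.prod_univ_eq_prod_range (fun i => g i (X i ω)) (n + 1)
    have hE_mul := (hind n).E_mul (f := fun x => ∏ i : Fin (n + 1), g i (x i))
      (g := fun y => σ * g (n + 1) y) (a := b ^ (n + 1)) (b := |σ| * b)
      (Finset.measurable_prod _ fun i _ => (hg i).comp (measurable_pi_apply i))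
      ((hg _).const_mul σ) (fun x => Finset.prod_nonneg fun i _ => hg0 _ _)
      (fun x => (Finset.prod_le_prod (fun i _ => hg0 _ _) fun i _ => hgb _ _).trans_eq
        (by simp only [Finset.prod_const, Finset.card_univ, Fintype.card_fin]))
      (fun y => by
        rw [abs_mul, abs_of_nonneg (hg0 _ y)]
        exact mul_le_mul_of_nonneg_left (hgb _ y) (abs_nonneg σ))
      (prod_mem (X := fun (i : Fin (n + 1)) ω => g i (X i ω)) _ fun i => hgX i)
      (const_mul_mem σ (hgX _))
    simp only [hprod, hc, EReal.toReal_coe] at hE_mul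
    calc S.E (fun ω => σ * ∏ i ∈ Finset.range (n + 1 + 1), g i (X i ω))
        = S.E (fun ω => (∏ i ∈ Finset.range (n + 1), g i (X i ω)) *
            (σ * g (n + 1) (X (n + 1) ω))) := by
          simp only [Finset.prod_range_succ _ (n + 1), mul_left_comm]
      _ = S.E (fun ω => c (n + 1) * (σ * ∏ i ∈ Finset.range (n + 1), g i (X i ω))) := by
          rw [hE_mul]
          simp only [mul_comm σ (c (n + 1)), mul_assoc]
      _ = ((c (n + 1) * (σ * ∏ i ∈ Finset.range (n + 1), c i) : ℝ) : EReal) := by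
          rw [S.pos_homog _ (const_mul_mem σ (prod_mem _ hgX)) _ (hc0 _), ih, ← EReal.coe_mul]
      _ = ((σ * ∏ i ∈ Finset.range (n + 1 + 1), c i : ℝ) : EReal) := by
          rw [Finset.prod_range_succ _ (n + 1)]
          ring_nf

theorem IndepSeq.E_prod_le {X : ℕ → Ω → ℝ} (hind : S.IndepSeq X) {g : ℕ → ℝ → ℝ}
    (hg : ∀ i, Measurable (g i)) (hg0 : ∀ i y, 0 ≤ g i y) {b : ℝ} (hgb : ∀ i y, g i y ≤ b)
    (hgX : ∀ i, (fun ω => g i (X i ω)) ∈ S.H) {c : ℕ → ℝ}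
    (hc : ∀ i, S.E (fun ω => g i (X i ω)) ≤ c i) (n : ℕ) :
    S.E (fun ω => ∏ i ∈ Finset.range (n + 1), g i (X i ω)) ≤
      ((∏ i ∈ Finset.range (n + 1), c i : ℝ) : EReal) := by
  have hE (i : ℕ) : ((S.E fun ω => g i (X i ω)).toReal : EReal) = S.E fun ω => g i (X i ω) :=
    coe_toReal_E (hgX i) (c := b) fun ω => by
      rw [abs_of_nonneg (hg0 i _)]
      exact hgb i _
  have hE0 (i : ℕ) : 0 ≤ (S.E fun ω => g i (X i ω)).toReal := by
    rw [← EReal.coe_le_coe_iff, hE]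
    exact le_E_of_forall_le (hgX i) fun ω => hg0 i _
  have hEprod := hind.E_const_mul_prod hg hg0 hgb hgX (σ := 1) hE0
    (fun i => by simp only [one_mul, hE]) n
  simp only [one_mul] at hEprod
  rw [hEprod, EReal.coe_le_coe_iff]
  refine Finset.prod_le_prod (fun i _ => hE0 i) fun i _ => ?_
  rw [← EReal.coe_le_coe_iff, hE]
  exact hc i

theorem prod_indicator_compl_preimage {ι κ β : Type*} (s : Finset ι) (X : ι → κ → β)
    (B : ι → Set β) (ω : κ) :
    ∏ i ∈ s, (B i)ᶜ.indicator (fun _ => (1 : ℝ)) (X i ω) =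
      (⋃ i ∈ s, X i ⁻¹' B i)ᶜ.indicator (fun _ => (1 : ℝ)) ω := by
  by_cases hω : ω ∈ ⋃ i ∈ s, X i ⁻¹' B i
  · obtain ⟨i, hi, hiB⟩ := Set.mem_iUnion₂.1 hω
    rw [Set.indicator_of_notMem (Set.notMem_compl_iff.2 hω)]
    have hiB' : X i ω ∉ (B i)ᶜ := Set.notMem_compl_iff.2 hiB
    exact Finset.prod_eq_zero hi (Set.indicator_of_notMem hiB' _)
  · rw [Set.indicator_of_mem hω]
    have hiB (i : ι) (hi : i ∈ s) : X i ω ∈ (B i)ᶜ :=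
      fun hiB => hω (Set.mem_iUnion₂.2 ⟨i, hi, hiB⟩)
    exact Finset.prod_eq_one fun i hi => Set.indicator_of_mem (hiB i hi) _

/-- `A ↦ 1 - V(Aᶜ)` is the lower probability, which is multiplicative on independent events. -/
theorem IndepSeq.one_sub_prob_biUnion {X : ℕ → Ω → ℝ} (hind : S.IndepSeq X)
    (hX : ∀ i, X i ∈ S.H) {B : ℕ → Set ℝ} (hB : ∀ i, MeasurableSet (B i)) (n : ℕ) :
    1 - S.prob (⋃ i ∈ Finset.range (n + 1), X i ⁻¹' B i) =
      ∏ i ∈ Finset.range (n + 1), (1 - S.prob (X i ⁻¹' B i)) := by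
  have hXB (i : ℕ) : MeasurableSet (X i ⁻¹' B i) := S.measurable_of_mem _ (hX i) (hB i)
  have hEprod := hind.E_const_mul_prod (g := fun i => (B i)ᶜ.indicator fun _ => (1 : ℝ))
    (σ := -1) (c := fun i => 1 - S.prob (X i ⁻¹' B i))
    (fun i => measurable_const.indicator (hB i).compl) (fun i => indicator_one_nonneg _)
    (fun i => indicator_one_le_one _) (fun i => S.indicator_mem _ (hXB i).compl)
    (fun i => sub_nonneg.2 (prob_le_one (hXB i)))
    (fun i => (E_neg_indicator_compl (hXB i)).trans (by congr 1; ring)) n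
  simp only [prod_indicator_compl_preimage] at hEprod
  rw [E_neg_indicator_compl (Finset.measurableSet_biUnion _ fun i _ => hXB i)] at hEprod
  linear_combination -EReal.coe_injective hEprod

end Independence

end SublinearExpectationSpace

/-! ### Power sums and Cesàro numbers -/

theorem mul_rpow_sub_one_le_rpow_sub_rpow {s x : ℝ} (hs0 : 0 ≤ s) (hs1 : s ≤ 1) (hx : 0 ≤ x) :
    s * (x + 1) ^ (s - 1) ≤ (x + 1) ^ s - x ^ s := by
  have hx1 : 0 < x + 1 := by positivity
  have hbernoulli : (1 + -1 / (x + 1)) ^ s ≤ 1 + s * (-1 / (x + 1)) :=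
    rpow_one_add_le_one_add_mul_self (by rw [le_div_iff₀ hx1]; linarith) hs0 hs1
  have hratio : 1 + -1 / (x + 1) = x / (x + 1) := by field_simp; ring
  rw [hratio, Real.div_rpow hx hx1.le, div_le_iff₀ (by positivity)] at hbernoulli
  rw [Real.rpow_sub_one hx1.ne']
  linear_combination hbernoulli

theorem exists_sum_rpow_sub_one_le {s : ℝ} (hs : 0 < s) :
    ∃ C : ℝ, 0 < C ∧ ∀ n : ℕ,
      ∑ i ∈ Finset.range n, ((i : ℝ) + 1) ^ (s - 1) ≤ C * (n : ℝ) ^ s := by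
  rcases le_total s 1 with hs1 | hs1
  · refine ⟨s⁻¹, by positivity, fun n => ?_⟩
    rw [inv_mul_eq_div, le_div_iff₀' hs, Finset.mul_sum]
    calc ∑ i ∈ Finset.range n, s * ((i : ℝ) + 1) ^ (s - 1)
        ≤ ∑ i ∈ Finset.range n, (((i + 1 : ℕ) : ℝ) ^ s - (i : ℝ) ^ s) :=
          Finset.sum_le_sum fun i _ => by
            rw [Nat.cast_add_one]
            exact mul_rpow_sub_one_le_rpow_sub_rpow hs.le hs1 i.cast_nonneg
      _ = (n : ℝ) ^ s := by
          rw [Finset.sum_range_sub fun i : ℕ => (i : ℝ) ^ s, Nat.cast_zero,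
            Real.zero_rpow hs.ne', sub_zero]
  · refine ⟨1, one_pos, fun n => ?_⟩
    calc ∑ i ∈ Finset.range n, ((i : ℝ) + 1) ^ (s - 1)
        ≤ ∑ _i ∈ Finset.range n, (n : ℝ) ^ (s - 1) := Finset.sum_le_sum fun i hi =>
          Real.rpow_le_rpow (by positivity) (by exact_mod_cast Finset.mem_range.1 hi)
            (by linarith)
      _ = 1 * (n : ℝ) ^ s := by
          rw [Finset.sum_const, Finset.card_range, nsmul_eq_mul, one_mul,
            ← Real.rpow_one_add' n.cast_nonneg (by linarith), add_sub_cancel]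

theorem exists_le_sum_Ico_rpow_sub_one (s : ℝ) :
    ∃ c : ℝ, 0 < c ∧ ∀ T : ℝ, 4 ≤ T →
      c * T ^ s ≤ ∑ n ∈ Finset.Ico ⌊T / 2⌋₊ ⌊T⌋₊, ((n : ℝ) + 1) ^ (s - 1) := by
  obtain ⟨c, hc, hpow⟩ : ∃ c : ℝ, 0 < c ∧ ∀ T x : ℝ, 0 < T → T / 2 ≤ x → x ≤ T →
      c * T ^ (s - 1) ≤ x ^ (s - 1) := by
    rcases le_total 0 (s - 1) with hs | hs
    · refine ⟨(1 / 2) ^ (s - 1), by positivity, fun T x hT hTx _ => ?_⟩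
      rw [← Real.mul_rpow (by norm_num) hT.le]
      exact Real.rpow_le_rpow (by positivity) (by linarith) hs
    · refine ⟨1, one_pos, fun T x hT hTx hxT => ?_⟩
      rw [one_mul]
      exact Real.rpow_le_rpow_of_nonpos (by linarith) hxT hs
  refine ⟨c / 4, by positivity, fun T hT => ?_⟩
  have hT0 : 0 < T := by linarith
  have hterm (n : ℕ) (hn : n ∈ Finset.Ico ⌊T / 2⌋₊ ⌊T⌋₊) :
      c * T ^ (s - 1) ≤ ((n : ℝ) + 1) ^ (s - 1) := by
    obtain ⟨hTn, hnT⟩ := Finset.mem_Ico.1 hn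
    refine hpow _ _ hT0 ((Nat.lt_floor_add_one _).le.trans (by gcongr)) ?_
    exact (by exact_mod_cast hnT : (n : ℝ) + 1 ≤ ⌊T⌋₊).trans (Nat.floor_le hT0.le)
  have hcard : T / 4 ≤ ((Finset.Ico ⌊T / 2⌋₊ ⌊T⌋₊).card : ℝ) := by
    rw [Nat.card_Ico, Nat.cast_sub (Nat.floor_le_floor (by linarith))]
    linarith [Nat.sub_one_lt_floor T, Nat.floor_le (show 0 ≤ T / 2 by positivity)]
  calc c / 4 * T ^ s = T / 4 * (c * T ^ (s - 1)) := by
        rw [Real.rpow_sub_one hT0.ne']; field_simp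
    _ ≤ (Finset.Ico ⌊T / 2⌋₊ ⌊T⌋₊).card • (c * T ^ (s - 1)) := by
        rw [nsmul_eq_mul]; gcongr
    _ ≤ _ := Finset.card_nsmul_le_sum _ _ _ hterm

theorem prod_one_add_div_le {α : ℝ} (hα : 0 ≤ α) (n : ℕ) :
    ∏ k ∈ Finset.range (n + 1), (1 + α / ((k : ℝ) + 1)) ≤ Real.exp α * ((n : ℝ) + 1) ^ α := by
  have hn : (0 : ℝ) < n + 1 := by positivity
  calc ∏ k ∈ Finset.range (n + 1), (1 + α / ((k : ℝ) + 1))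
      ≤ ∏ k ∈ Finset.range (n + 1), Real.exp (α / ((k : ℝ) + 1)) :=
        Finset.prod_le_prod (fun k _ => by positivity) fun k _ => by
          rw [add_comm]; exact Real.add_one_le_exp _
    _ = Real.exp (α * (harmonic (n + 1) : ℝ)) := by
        rw [← Real.exp_sum, harmonic]
        push_cast
        simp only [Finset.mul_sum, div_eq_mul_inv]
    _ ≤ Real.exp (α * (1 + Real.log (n + 1))) := by
        gcongr
        exact_mod_cast harmonic_le_one_add_log (n + 1)
    _ = Real.exp α * ((n : ℝ) + 1) ^ α := by
        rw [Real.rpow_def_of_pos hn, ← Real.exp_add]; ring_nf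

theorem rpow_le_prod_one_add_div {α : ℝ} (hα0 : 0 ≤ α) (hα1 : α ≤ 1) (n : ℕ) :
    ((n : ℝ) + 1) ^ α ≤ ∏ k ∈ Finset.range n, (1 + α / ((k : ℝ) + 1)) := by
  induction n with
  | zero => simp only [Nat.cast_zero, zero_add, Real.one_rpow, Finset.prod_range_zero, le_refl]
  | succ n ih =>
    have hn : (0 : ℝ) < n + 1 := by positivity
    have hbernoulli : (1 + 1 / ((n : ℝ) + 1)) ^ α ≤ 1 + α * (1 / ((n : ℝ) + 1)) :=
      rpow_one_add_le_one_add_mul_self (by linarith [one_div_pos.2 hn]) hα0 hα1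
    calc (((n + 1 : ℕ) : ℝ) + 1) ^ α = ((n : ℝ) + 1) ^ α * (1 + 1 / ((n : ℝ) + 1)) ^ α := by
          rw [← Real.mul_rpow hn.le (by positivity)]
          congr 1
          push_cast
          field_simp
      _ ≤ (∏ k ∈ Finset.range n, (1 + α / ((k : ℝ) + 1))) * (1 + α / ((n : ℝ) + 1)) := by
          rw [mul_one_div] at hbernoulli
          gcongr
      _ = _ := (Finset.prod_range_succ _ n).symm

theorem cesaroNumber_succ (α : ℝ) (n : ℕ) :
    cesaroNumber α (n + 1) = ∏ k ∈ Finset.range (n + 1), (1 + α / ((k : ℝ) + 1)) := by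
  rw [cesaroNumber, if_neg n.succ_ne_zero, ← Finset.prod_range_add_one_eq_factorial]
  push_cast
  rw [← Finset.prod_div_distrib]
  refine Finset.prod_congr rfl fun k _ => ?_
  field_simp
  ring

theorem cesaroNumber_sub_one_succ {α : ℝ} (hα : 0 < α) (n : ℕ) :
    cesaroNumber (α - 1) (n + 1) = cesaroNumber α (n + 1) * (α / (α + (n + 1))) := by
  simp only [cesaroNumber_succ]
  induction n with
  | zero =>
    simp only [zero_add, Finset.prod_range_one, Nat.cast_zero, div_one]
    field_simp
    ring
  | succ n ih =>
    rw [Finset.prod_range_succ, ih, Finset.prod_range_succ _ (n + 1)]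
    push_cast
    field_simp
    ring

theorem rpow_le_cesaroNumber {α : ℝ} (hα0 : 0 ≤ α) (hα1 : α ≤ 1) (n : ℕ) :
    ((n : ℝ) + 1) ^ α ≤ cesaroNumber α (n + 1) := by
  rw [cesaroNumber_succ]
  refine le_trans ?_ (rpow_le_prod_one_add_div hα0 hα1 (n + 1))
  gcongr
  exact n.le_succ

theorem cesaroNumber_le {α : ℝ} (hα : 0 ≤ α) (n : ℕ) :
    cesaroNumber α (n + 1) ≤ Real.exp α * ((n : ℝ) + 1) ^ α :=
  cesaroNumber_succ α n ▸ prod_one_add_div_le hα n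

theorem rpow_le_cesaroNumber_sub_one {α : ℝ} (hα0 : 0 < α) (hα1 : α ≤ 1) (n : ℕ) :
    α / 2 * ((n : ℝ) + 1) ^ (α - 1) ≤ cesaroNumber (α - 1) (n + 1) := by
  have hn : (0 : ℝ) < n + 1 := by positivity
  calc α / 2 * ((n : ℝ) + 1) ^ (α - 1) = ((n : ℝ) + 1) ^ α * (α / (2 * (n + 1))) := by
        rw [Real.rpow_sub_one hn.ne']; field_simp
    _ ≤ cesaroNumber α (n + 1) * (α / (α + (n + 1))) := by
        gcongr
        · exact (Real.rpow_nonneg hn.le α).trans (rpow_le_cesaroNumber hα0.le hα1 n)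
        · exact rpow_le_cesaroNumber hα0.le hα1 n
        · linarith [n.cast_nonneg (α := ℝ)]
    _ = _ := (cesaroNumber_sub_one_succ hα0 n).symm

theorem cesaroNumber_sub_one_le {α : ℝ} (hα0 : 0 < α) (hα1 : α ≤ 1) (n : ℕ) :
    cesaroNumber (α - 1) (n + 1) ≤ Real.exp α * ((n : ℝ) + 1) ^ (α - 1) := by
  have hn : (0 : ℝ) < n + 1 := by positivity
  calc cesaroNumber (α - 1) (n + 1) = cesaroNumber α (n + 1) * (α / (α + (n + 1))) :=
        cesaroNumber_sub_one_succ hα0 n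
    _ ≤ Real.exp α * ((n : ℝ) + 1) ^ α * (1 / (n + 1)) := by
        have hden : (n : ℝ) + 1 ≤ α + (n + 1) := le_add_of_nonneg_left hα0.le
        gcongr
        exact cesaroNumber_le hα0.le n
    _ = _ := by rw [Real.rpow_sub_one hn.ne', mul_one_div, mul_div_assoc]

/-- The order of magnitude `(n+1)^α (k+1)^(1-α)` of the weight quotient
`A_{n+1}^α / A_{k+1}^(α-1)`: the variable with index `n - k` becomes visible in the `n`-th weighted
sum once it exceeds the `p`-th power of this quantity. -/
noncomputable def triangleThreshold (α : ℝ) (i : ℕ × ℕ) : ℝ :=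
  ((i.1 : ℝ) + 1) ^ α * ((i.2 : ℝ) + 1) ^ (1 - α)

theorem cesaroNumber_ratio_mul_triangleThreshold_le {α : ℝ} (hα0 : 0 < α) (hα1 : α ≤ 1)
    (n k : ℕ) :
    cesaroNumber (α - 1) (k + 1) / cesaroNumber α (n + 1) * triangleThreshold α (n, k) ≤
      Real.exp α := by
  have hk : (0 : ℝ) < k + 1 := by positivity
  calc cesaroNumber (α - 1) (k + 1) / cesaroNumber α (n + 1) * triangleThreshold α (n, k)
      ≤ Real.exp α * ((k : ℝ) + 1) ^ (α - 1) / ((n : ℝ) + 1) ^ α *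
          (((n : ℝ) + 1) ^ α * ((k : ℝ) + 1) ^ (1 - α)) := by
        rw [triangleThreshold]
        gcongr
        · exact cesaroNumber_sub_one_le hα0 hα1 k
        · exact rpow_le_cesaroNumber hα0.le hα1 n
    _ = Real.exp α * (((k : ℝ) + 1) ^ (α - 1) * ((k : ℝ) + 1) ^ (1 - α)) := by field_simp
    _ = Real.exp α := by rw [← Real.rpow_add hk, sub_add_sub_cancel, sub_self, Real.rpow_zero,
        mul_one]

theorem le_cesaroNumber_ratio_mul_triangleThreshold {α : ℝ} (hα0 : 0 < α) (hα1 : α ≤ 1)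
    (n k : ℕ) :
    α / 2 / Real.exp α ≤
      cesaroNumber (α - 1) (k + 1) / cesaroNumber α (n + 1) * triangleThreshold α (n, k) := by
  have hn : (0 : ℝ) < n + 1 := by positivity
  have hk : (0 : ℝ) < k + 1 := by positivity
  have hA : 0 < cesaroNumber α (n + 1) :=
    (Real.rpow_pos_of_pos hn α).trans_le (rpow_le_cesaroNumber hα0.le hα1 n)
  calc α / 2 / Real.exp α
      = α / 2 / Real.exp α * (((k : ℝ) + 1) ^ (α - 1) * ((k : ℝ) + 1) ^ (1 - α)) := by
        rw [← Real.rpow_add hk, sub_add_sub_cancel, sub_self, Real.rpow_zero, mul_one]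
    _ = α / 2 * ((k : ℝ) + 1) ^ (α - 1) / (Real.exp α * ((n : ℝ) + 1) ^ α) *
          (((n : ℝ) + 1) ^ α * ((k : ℝ) + 1) ^ (1 - α)) := by field_simp
    _ ≤ _ := by
        rw [triangleThreshold]
        gcongr
        · exact (by positivity : (0 : ℝ) ≤ α / 2 * ((k : ℝ) + 1) ^ (α - 1)).trans
            (rpow_le_cesaroNumber_sub_one hα0 hα1 k)
        · exact rpow_le_cesaroNumber_sub_one hα0 hα1 k
        · exact cesaroNumber_le hα0.le n

/-! ### Choquet integrals and thresholds -/

section LayerCake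

open MeasureTheory

theorem measure_le_of_isLowerSet {μ ν : Measure ℝ} {C D : ℝ≥0∞}
    (h : ∀ x, μ (Set.Iic x) ≤ C * ν (Set.Iic x) + D) {L : Set ℝ} (hL : IsLowerSet L) :
    μ L ≤ C * ν L + D := by
  have : L.OrdConnected := hL.ordConnected
  have hunion : ⋃ x : L, Set.Iic (x : ℝ) = L := by
    ext y
    simp only [Set.mem_iUnion, Set.mem_Iic, Subtype.exists, exists_prop]
    exact ⟨fun ⟨x, hx, hyx⟩ => hL hyx hx, fun hy => ⟨y, hy, le_rfl⟩⟩
  have hmono : Monotone fun x : L => Set.Iic (x : ℝ) := fun _ _ hxy => Set.Iic_subset_Iic.2 hxy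
  calc μ L = ⨆ x : L, μ (Set.Iic (x : ℝ)) := by rw [← hmono.measure_iUnion, hunion]
    _ ≤ C * ν L + D := iSup_le fun x => (h x).trans (by
        gcongr
        exact fun y hy => hL hy x.2)

theorem lintegral_antitone_le {μ ν : Measure ℝ} {v : ℝ → ℝ} (hv : Antitone v)
    (hv0 : ∀ x, 0 ≤ v x) (hv1 : ∀ x, v x ≤ 1) {C D : ℝ≥0∞} (hC : C ≠ ⊤)
    (h : ∀ x, μ (Set.Iic x) ≤ C * ν (Set.Iic x) + D) :
    ∫⁻ x, ENNReal.ofReal (v x) ∂μ ≤ C * ∫⁻ x, ENNReal.ofReal (v x) ∂ν + D := by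
  have hlower (u : ℝ) : IsLowerSet {x | u < v x} := fun x y hyx hx => lt_of_lt_of_le hx (hv hyx)
  rw [lintegral_eq_lintegral_meas_lt μ (.of_forall hv0) hv.measurable.aemeasurable,
    lintegral_eq_lintegral_meas_lt ν (.of_forall hv0) hv.measurable.aemeasurable]
  calc ∫⁻ u in Set.Ioi 0, μ {x | u < v x}
      ≤ ∫⁻ u in Set.Ioi 0, (C * ν {x | u < v x} + (Set.Iic (1 : ℝ)).indicator (fun _ => D) u) := by
        refine lintegral_mono fun u => ?_
        rcases le_or_gt u 1 with hu | hu
        · rw [Set.indicator_of_mem (Set.mem_Iic.2 hu)]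
          exact measure_le_of_isLowerSet h (hlower u)
        · have hempty : {x | u < v x} = ∅ :=
            Set.eq_empty_of_forall_notMem fun x hx => (hx.trans_le (hv1 x)).not_gt hu
          rw [hempty, measure_empty]
          exact zero_le
    _ = C * (∫⁻ u in Set.Ioi 0, ν {x | u < v x}) +
          ∫⁻ u in Set.Ioi 0, (Set.Iic (1 : ℝ)).indicator (fun _ => D) u := by
        rw [lintegral_add_right _ (measurable_const.indicator measurableSet_Iic),
          lintegral_const_mul' _ _ hC]
    _ = C * (∫⁻ u in Set.Ioi 0, ν {x | u < v x}) + D := by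
        rw [lintegral_indicator_const measurableSet_Iic,
          Measure.restrict_apply measurableSet_Iic, Set.inter_comm, Set.Ioi_inter_Iic,
          Real.volume_Ioc, sub_zero, ENNReal.ofReal_one, mul_one]

theorem exists_le_const_mul_add_of_isBigO {f g : ℝ → ℝ} (hf : MonotoneOn f (Set.Ici 0))
    (h : f =O[Filter.atTop] g) :
    ∃ C : ℝ, 0 ≤ C ∧ ∃ D : ℝ, ∀ t, 0 ≤ t → f t ≤ C * |g t| + D := by
  obtain ⟨C, hC, hCg⟩ := h.exists_nonneg
  obtain ⟨t₀, ht₀⟩ := Filter.eventually_atTop.1 hCg.bound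
  simp only [Real.norm_eq_abs] at ht₀
  refine ⟨C, hC, |f (max t₀ 0)|, fun t ht => ?_⟩
  rcases le_total t₀ t with htt | htt
  · linarith [le_abs_self (f t), ht₀ t htt, abs_nonneg (f (max t₀ 0))]
  · linarith [hf ht (le_max_right t₀ 0) (le_max_of_le_left htt), le_abs_self (f (max t₀ 0)),
      mul_nonneg hC (abs_nonneg (g t))]

/-- The discrete measure with mass `w i` at the point `y i`; its distribution function counts the
`y i` with weights. -/
noncomputable def weightedDirac {ι : Type*} (w : ι → ℝ≥0∞) (y : ι → ℝ) : Measure ℝ :=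
  Measure.sum fun i => w i • Measure.dirac (y i)

variable {ι : Type*} {w : ι → ℝ≥0∞} {y : ι → ℝ}

theorem lintegral_weightedDirac (f : ℝ → ℝ≥0∞) :
    ∫⁻ x, f x ∂weightedDirac w y = ∑' i, w i * f (y i) := by
  simp only [weightedDirac, lintegral_sum_measure, lintegral_smul_measure, lintegral_dirac,
    smul_eq_mul]

theorem weightedDirac_Iic (x : ℝ) :
    weightedDirac w y (Set.Iic x) = ∑' i, if y i ≤ x then w i else 0 := by
  simp only [weightedDirac, Measure.sum_apply _ measurableSet_Iic, Measure.smul_apply,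
    Measure.dirac_apply, Set.indicator_apply, Set.mem_Iic, Pi.one_apply, smul_eq_mul, mul_ite,
    mul_one, mul_zero]

theorem volume_restrict_Ioi_Iic (x : ℝ) :
    volume.restrict (Set.Ioi 0) (Set.Iic x) = ENNReal.ofReal x := by
  rw [Measure.restrict_apply measurableSet_Iic, Set.inter_comm, Set.Ioi_inter_Iic,
    Real.volume_Ioc, sub_zero]

variable {v ψ : ℝ → ℝ} {τ : ι → ℝ}

theorem weightedDirac_comp_Iic (hψ : StrictMonoOn ψ (Set.Ici 0)) (hτ : ∀ i, 0 ≤ τ i) {t : ℝ}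
    (ht : 0 ≤ t) :
    weightedDirac w (fun i => ψ (τ i)) (Set.Iic (ψ t)) = weightedDirac w τ (Set.Iic t) := by
  simp only [weightedDirac_Iic, hψ.le_iff_le (Set.mem_Ici.2 (hτ _)) (Set.mem_Ici.2 ht)]

theorem lintegral_lt_top_iff_tsum_lt_top (hv : Antitone v) (hv0 : ∀ x, 0 ≤ v x)
    (hv1 : ∀ x, v x ≤ 1) (hτ : ∀ i, 0 ≤ τ i) (hψ : StrictMonoOn ψ (Set.Ici 0))
    (hψmaps : Set.MapsTo ψ (Set.Ici 0) (Set.Ici 0)) (hψsurj : Set.SurjOn ψ (Set.Ici 0) (Set.Ici 0))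
    (hfin : ∀ t, weightedDirac w τ (Set.Iic t) ≠ ⊤)
    (hΘ : (fun t => (weightedDirac w τ).real (Set.Iic t)) =Θ[Filter.atTop] ψ) :
    ∫⁻ x in Set.Ioi 0, ENNReal.ofReal (v x) < ⊤ ↔
      ∑' i, w i * ENNReal.ofReal (v (ψ (τ i))) < ⊤ := by
  set N : ℝ → ℝ := fun t => (weightedDirac w τ).real (Set.Iic t)
  have hN0 (t : ℝ) : 0 ≤ N t := measureReal_nonneg
  have hNmono : Monotone N := fun s t hst => measureReal_mono (Set.Iic_subset_Iic.2 hst) (hfin t)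
  have hNψ (t : ℝ) (ht : 0 ≤ t) :
      weightedDirac w (fun i => ψ (τ i)) (Set.Iic (ψ t)) = ENNReal.ofReal (N t) := by
    rw [weightedDirac_comp_Iic hψ hτ ht, ofReal_measureReal (hfin t)]
  obtain ⟨C, hC, D, hle⟩ := exists_le_const_mul_add_of_isBigO (hNmono.monotoneOn _) hΘ.1
  obtain ⟨C', hC', D', hge⟩ := exists_le_const_mul_add_of_isBigO hψ.monotoneOn hΘ.2
  rw [← lintegral_weightedDirac (w := w) (y := fun i => ψ (τ i)) fun x => ENNReal.ofReal (v x)]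
  constructor <;> intro hlt
  · refine (lintegral_antitone_le hv hv0 hv1 (C := ENNReal.ofReal C) (D := ENNReal.ofReal D)
      ENNReal.ofReal_ne_top fun x => ?_).trans_lt (by finiteness)
    rcases lt_or_ge x 0 with hx | hx
    · rw [weightedDirac_Iic, ENNReal.tsum_eq_zero.2 fun i =>
        if_neg (hx.trans_le (hψmaps (hτ i))).not_ge]
      exact zero_le
    · obtain ⟨t, ht, rfl⟩ := hψsurj hx
      rw [volume_restrict_Ioi_Iic, hNψ t ht, ← ENNReal.ofReal_mul hC]
      exact (ENNReal.ofReal_le_ofReal (by simpa only [abs_of_nonneg hx] using hle t ht)).trans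
        ENNReal.ofReal_add_le
  · refine (lintegral_antitone_le hv hv0 hv1 (C := ENNReal.ofReal C') (D := ENNReal.ofReal D')
      ENNReal.ofReal_ne_top fun x => ?_).trans_lt (by finiteness)
    rcases lt_or_ge x 0 with hx | hx
    · rw [volume_restrict_Ioi_Iic, ENNReal.ofReal_of_nonpos hx.le]
      exact zero_le
    · obtain ⟨t, ht, rfl⟩ := hψsurj hx
      rw [volume_restrict_Ioi_Iic, hNψ t ht, ← ENNReal.ofReal_mul hC']
      exact (ENNReal.ofReal_le_ofReal (by simpa only [abs_of_nonneg (hN0 t)] using hge t ht)).trans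
        ENNReal.ofReal_add_le

end LayerCake

section TriangleCount

open Asymptotics Filter

/-- The weight `(n+1)^(r-2)` on the triangle `k ≤ n`, as a function on all pairs `(n, k)`. -/
noncomputable def triangleWeight (r : ℝ) (i : ℕ × ℕ) : ℝ≥0∞ :=
  if i.2 ≤ i.1 then ENNReal.ofReal (((i.1 : ℝ) + 1) ^ (r - 2)) else 0

/-- The distribution of the thresholds over the weighted triangle of pairs `k ≤ n`. -/
noncomputable def triangleMeasure (r α : ℝ) : MeasureTheory.Measure ℝ :=
  weightedDirac (triangleWeight r) (triangleThreshold α)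

/-- The partial sums `∑_{k < N} (k+1)^(-e)` of the series defining `ζ(e)`. -/
noncomputable def zetaSum (e : ℝ) (N : ℕ) : ℝ :=
  ∑ k ∈ Finset.range N, ((k : ℝ) + 1) ^ (-e)

/-- The real solution `x` of `x ^ α * (k+1) ^ (1-α) = t`, so that `(n, k)` has threshold at most
`t` exactly when `n + 1 ≤ x`. -/
noncomputable def thresholdRoot (α t : ℝ) (k : ℕ) : ℝ :=
  (t / ((k : ℝ) + 1) ^ (1 - α)) ^ α⁻¹

variable {r α t : ℝ}

theorem le_thresholdRoot_iff (hα : 0 < α) (ht : 0 ≤ t) {x : ℝ} (hx : 0 ≤ x) (k : ℕ) :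
    x ≤ thresholdRoot α t k ↔ x ^ α * ((k : ℝ) + 1) ^ (1 - α) ≤ t := by
  rw [thresholdRoot, Real.le_rpow_inv_iff_of_pos hx (by positivity) hα, le_div_iff₀ (by positivity)]

theorem triangleThreshold_le_iff (hα : 0 < α) (ht : 0 ≤ t) (n k : ℕ) :
    triangleThreshold α (n, k) ≤ t ↔ n < ⌊thresholdRoot α t k⌋₊ := by
  rw [← Nat.succ_le_iff, Nat.le_floor_iff (by unfold thresholdRoot; positivity),
    le_thresholdRoot_iff hα ht (by positivity), triangleThreshold, Nat.cast_succ]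

theorem lt_floor_thresholdRoot_self_iff (hα : 0 < α) (ht : 0 ≤ t) (k : ℕ) :
    k < ⌊thresholdRoot α t k⌋₊ ↔ k < ⌊t⌋₊ := by
  rw [← triangleThreshold_le_iff hα ht, triangleThreshold, ← Real.rpow_add (by positivity),
    add_sub_cancel, Real.rpow_one, ← Nat.succ_le_iff, Nat.le_floor_iff ht, Nat.cast_succ]

theorem thresholdRoot_rpow (ht : 0 ≤ t) (k : ℕ) :
    thresholdRoot α t k ^ (r - 1) =
      t ^ ((r - 1) / α) * ((k : ℝ) + 1) ^ (-((1 - α) * ((r - 1) / α))) := by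
  have hk : (0 : ℝ) ≤ k + 1 := by positivity
  rw [thresholdRoot, ← Real.rpow_mul (by positivity), inv_mul_eq_div,
    Real.div_rpow ht (by positivity), ← Real.rpow_mul hk, Real.rpow_neg hk, div_eq_mul_inv]

theorem tsum_column (hα : 0 < α) (ht : 0 ≤ t) (k : ℕ) :
    ∑' n, (if triangleThreshold α (n, k) ≤ t then triangleWeight r (n, k) else 0) =
      ENNReal.ofReal (∑ n ∈ Finset.Ico k ⌊thresholdRoot α t k⌋₊, ((n : ℝ) + 1) ^ (r - 2)) := by
  rw [ENNReal.ofReal_sum_of_nonneg fun n _ => by positivity, tsum_eq_sum]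
  · refine Finset.sum_congr rfl fun n hn => ?_
    obtain ⟨hkn, hn⟩ := Finset.mem_Ico.1 hn
    rw [if_pos ((triangleThreshold_le_iff hα ht n k).2 hn), triangleWeight, if_pos hkn]
  · intro n hn
    simp only [triangleThreshold_le_iff hα ht, triangleWeight]
    split_ifs with hnT hkn
    · exact absurd (Finset.mem_Ico.2 ⟨hkn, hnT⟩) hn
    all_goals rfl

theorem triangleMeasure_Iic (hα : 0 < α) (ht : 0 ≤ t) :
    triangleMeasure r α (Set.Iic t) = ENNReal.ofReal (∑ k ∈ Finset.range ⌊t⌋₊,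
      ∑ n ∈ Finset.Ico k ⌊thresholdRoot α t k⌋₊, ((n : ℝ) + 1) ^ (r - 2)) := by
  rw [triangleMeasure, weightedDirac_Iic, ENNReal.tsum_prod', ENNReal.tsum_comm]
  simp only [tsum_column hα ht]
  rw [ENNReal.ofReal_sum_of_nonneg fun k _ => Finset.sum_nonneg fun n _ => by positivity]
  refine tsum_eq_sum fun k hk => ?_
  rw [Finset.mem_range, ← lt_floor_thresholdRoot_self_iff hα ht] at hk
  rw [Finset.Ico_eq_empty hk, Finset.sum_empty, ENNReal.ofReal_zero]

theorem triangleMeasure_real_Iic (hα : 0 < α) (ht : 0 ≤ t) :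
    (triangleMeasure r α).real (Set.Iic t) = ∑ k ∈ Finset.range ⌊t⌋₊,
      ∑ n ∈ Finset.Ico k ⌊thresholdRoot α t k⌋₊, ((n : ℝ) + 1) ^ (r - 2) := by
  rw [MeasureTheory.Measure.real, triangleMeasure_Iic hα ht, ENNReal.toReal_ofReal]
  exact Finset.sum_nonneg fun k _ => Finset.sum_nonneg fun n _ => by positivity

theorem triangleMeasure_Iic_ne_top (hα : 0 < α) (t : ℝ) :
    triangleMeasure r α (Set.Iic t) ≠ ⊤ := by
  refine ne_top_of_le_ne_top ?_
    (MeasureTheory.measure_mono (Set.Iic_subset_Iic.2 (le_max_left t 0)))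
  rw [triangleMeasure_Iic hα (le_max_right t 0)]
  exact ENNReal.ofReal_ne_top

theorem triangleMeasure_isBigO (hr : 1 < r) (hα : 0 < α) :
    (fun t => (triangleMeasure r α).real (Set.Iic t)) =O[atTop]
      fun t => t ^ ((r - 1) / α) * zetaSum ((1 - α) * ((r - 1) / α)) ⌊t⌋₊ := by
  obtain ⟨C, hC, hsum⟩ := exists_sum_rpow_sub_one_le (sub_pos.2 hr)
  refine IsBigO.of_bound C (eventually_atTop.2 ⟨0, fun t ht => ?_⟩)
  rw [Real.norm_of_nonneg MeasureTheory.measureReal_nonneg, triangleMeasure_real_Iic hα ht,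
    zetaSum, Finset.mul_sum, Real.norm_of_nonneg (Finset.sum_nonneg fun k _ => by positivity),
    Finset.mul_sum]
  refine Finset.sum_le_sum fun k _ => ?_
  calc ∑ n ∈ Finset.Ico k ⌊thresholdRoot α t k⌋₊, ((n : ℝ) + 1) ^ (r - 2)
      ≤ ∑ n ∈ Finset.range ⌊thresholdRoot α t k⌋₊, ((n : ℝ) + 1) ^ (r - 1 - 1) := by
        rw [show r - 1 - 1 = r - 2 by ring, Finset.range_eq_Ico]
        exact Finset.sum_le_sum_of_subset_of_nonneg (Finset.Ico_subset_Ico_left k.zero_le)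
          fun n _ _ => by positivity
    _ ≤ C * (⌊thresholdRoot α t k⌋₊ : ℝ) ^ (r - 1) := hsum _
    _ ≤ C * thresholdRoot α t k ^ (r - 1) := by
        have hroot : 0 ≤ thresholdRoot α t k := by unfold thresholdRoot; positivity
        gcongr
        exact Nat.floor_le hroot
    _ = _ := by rw [thresholdRoot_rpow ht]

theorem sum_range_mul_le_of_antitone {f : ℕ → ℝ} (hf : Antitone f) (m n : ℕ) :
    ∑ i ∈ Finset.range (m * n), f i ≤ m * ∑ i ∈ Finset.range n, f i := by
  induction m with
  | zero => simp only [zero_mul, Finset.range_zero, Finset.sum_empty, Nat.cast_zero, le_refl]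
  | succ m ih =>
    rw [Nat.succ_mul, Finset.sum_range_add, Nat.cast_succ, add_one_mul]
    exact add_le_add ih (Finset.sum_le_sum fun i _ => hf (Nat.le_add_left i _))

theorem zetaSum_floor_le {e : ℝ} (he : 0 ≤ e) (ht : 4 ≤ t) :
    zetaSum e ⌊t⌋₊ ≤ 8 * zetaSum e ⌊t / 4⌋₊ := by
  have hfloor : ⌊t⌋₊ ≤ 8 * ⌊t / 4⌋₊ := by
    have hone : (1 : ℝ) ≤ ⌊t / 4⌋₊ := by
      exact_mod_cast Nat.le_floor (by rw [Nat.cast_one]; linarith)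
    refine Nat.floor_le_of_le ?_
    push_cast
    linarith [Nat.lt_floor_add_one (t / 4)]
  have hanti : Antitone fun k : ℕ => ((k : ℝ) + 1) ^ (-e) := fun i j hij =>
    Real.rpow_le_rpow_of_nonpos (by positivity) (by gcongr) (neg_nonpos.2 he)
  calc zetaSum e ⌊t⌋₊ ≤ zetaSum e (8 * ⌊t / 4⌋₊) :=
        Finset.sum_le_sum_of_subset_of_nonneg (Finset.range_subset_range.2 hfloor)
          fun k _ _ => by positivity
    _ ≤ 8 * zetaSum e ⌊t / 4⌋₊ := by
        simpa only [zetaSum, Nat.cast_ofNat] using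
          sum_range_mul_le_of_antitone hanti 8 ⌊t / 4⌋₊

theorem le_thresholdRoot (hα0 : 0 < α) (hα1 : α ≤ 1) {k : ℕ} (hkt : (k : ℝ) + 1 ≤ t) :
    t ≤ thresholdRoot α t k := by
  have ht : 0 < t := (by positivity : (0 : ℝ) < k + 1).trans_le hkt
  rw [le_thresholdRoot_iff hα0 ht.le ht.le]
  calc t ^ α * ((k : ℝ) + 1) ^ (1 - α) ≤ t ^ α * t ^ (1 - α) := by
        have := sub_nonneg.2 hα1
        gcongr
    _ = t := by rw [← Real.rpow_add ht, add_sub_cancel, Real.rpow_one]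

theorem exists_le_triangleMeasure (r : ℝ) (hα0 : 0 < α) (hα1 : α ≤ 1) :
    ∃ c : ℝ, 0 < c ∧ ∀ t, 4 ≤ t →
      c * (t ^ ((r - 1) / α) * zetaSum ((1 - α) * ((r - 1) / α)) ⌊t / 4⌋₊) ≤
        (triangleMeasure r α).real (Set.Iic t) := by
  obtain ⟨c, hc, hsum⟩ := exists_le_sum_Ico_rpow_sub_one (r - 1)
  refine ⟨c, hc, fun t ht => ?_⟩
  have ht0 : 0 ≤ t := by linarith
  rw [triangleMeasure_real_Iic hα0 ht0, zetaSum, Finset.mul_sum, Finset.mul_sum]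
  refine (Finset.sum_le_sum fun k hk => ?_).trans (Finset.sum_le_sum_of_subset_of_nonneg
    (Finset.range_subset_range.2 (Nat.floor_le_floor (by linarith : t / 4 ≤ t)))
    fun k _ _ => Finset.sum_nonneg fun n _ => by positivity)
  have hk4 : (k : ℝ) + 1 ≤ t / 4 := by
    exact_mod_cast (Nat.le_floor_iff (by positivity)).1 (Finset.mem_range.1 hk)
  have hroot : t ≤ thresholdRoot α t k := le_thresholdRoot hα0 hα1 (by linarith)
  have hk2 : k ≤ ⌊thresholdRoot α t k / 2⌋₊ := Nat.le_floor (by linarith)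
  rw [← thresholdRoot_rpow ht0]
  calc c * thresholdRoot α t k ^ (r - 1)
      ≤ ∑ n ∈ Finset.Ico ⌊thresholdRoot α t k / 2⌋₊ ⌊thresholdRoot α t k⌋₊,
          ((n : ℝ) + 1) ^ (r - 1 - 1) := hsum _ (ht.trans hroot)
    _ ≤ _ := by
        rw [show r - 1 - 1 = r - 2 by ring]
        exact Finset.sum_le_sum_of_subset_of_nonneg (Finset.Ico_subset_Ico_left hk2)
          fun n _ _ => by positivity

theorem triangleMeasure_isTheta (hr : 1 < r) (hα0 : 0 < α) (hα1 : α ≤ 1) :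
    (fun t => (triangleMeasure r α).real (Set.Iic t)) =Θ[atTop]
      fun t => t ^ ((r - 1) / α) * zetaSum ((1 - α) * ((r - 1) / α)) ⌊t⌋₊ := by
  set e := (1 - α) * ((r - 1) / α)
  have he : 0 ≤ e := mul_nonneg (sub_nonneg.2 hα1) (div_nonneg (sub_nonneg.2 hr.le) hα0.le)
  refine ⟨triangleMeasure_isBigO hr hα0, ?_⟩
  obtain ⟨c, hc, hle⟩ := exists_le_triangleMeasure r hα0 hα1
  refine IsBigO.of_bound (8 / c) (eventually_atTop.2 ⟨4, fun t ht => ?_⟩)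
  have : 0 ≤ t := by linarith
  have hzeta : 0 ≤ zetaSum e ⌊t⌋₊ := Finset.sum_nonneg fun k _ => by positivity
  rw [Real.norm_of_nonneg MeasureTheory.measureReal_nonneg, Real.norm_of_nonneg (by positivity),
    div_mul_eq_mul_div, le_div_iff₀' hc]
  calc c * (t ^ ((r - 1) / α) * zetaSum e ⌊t⌋₊)
      ≤ c * (t ^ ((r - 1) / α) * (8 * zetaSum e ⌊t / 4⌋₊)) := by
        gcongr
        exact zetaSum_floor_le he ht
    _ = 8 * (c * (t ^ ((r - 1) / α) * zetaSum e ⌊t / 4⌋₊)) := by ring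
    _ ≤ 8 * (triangleMeasure r α).real (Set.Iic t) := by gcongr; exact hle t ht

theorem zetaSum_isTheta_one {e : ℝ} (he : 1 < e) :
    (fun t => zetaSum e ⌊t⌋₊) =Θ[atTop] fun _ : ℝ => (1 : ℝ) := by
  have hsummable : Summable fun k : ℕ => ((k : ℝ) + 1) ^ (-e) := by
    simpa only [Nat.cast_add_one] using
      (summable_nat_add_iff 1).2 (Real.summable_nat_rpow.2 (neg_lt_neg he))
  have hpos : 0 < ∑' k : ℕ, ((k : ℝ) + 1) ^ (-e) :=
    hsummable.tsum_pos (fun _ => by positivity) 0 (by positivity)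
  have hlim : Tendsto (fun t : ℝ => zetaSum e ⌊t⌋₊) atTop (nhds (∑' k : ℕ, ((k : ℝ) + 1) ^ (-e))) :=
    hsummable.hasSum.tendsto_sum_nat.comp tendsto_nat_floor_atTop
  exact ((isEquivalent_const_iff_tendsto hpos.ne').2 hlim).isTheta.trans
    (isTheta_const_const hpos.ne' one_ne_zero)

theorem zetaSum_one (N : ℕ) : zetaSum 1 N = (harmonic N : ℝ) := by
  simp only [zetaSum, Real.rpow_neg_one, harmonic, Rat.cast_sum, Rat.cast_inv, Nat.cast_add_one,
    Rat.cast_add, Rat.cast_natCast, Rat.cast_one]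

theorem zetaSum_one_isTheta_log : (fun t => zetaSum 1 ⌊t⌋₊) =Θ[atTop] Real.log := by
  constructor
  · refine IsBigO.of_bound 2 (eventually_atTop.2 ⟨Real.exp 1, fun t ht => ?_⟩)
    have ht1 : 1 ≤ t := Real.one_le_exp zero_le_one |>.trans ht
    have hlog : 1 ≤ Real.log t := (Real.le_log_iff_exp_le (by linarith)).2 ht
    rw [zetaSum_one, Real.norm_of_nonneg (by linarith [log_le_harmonic_floor t (by linarith)]),
      Real.norm_of_nonneg (by linarith)]
    linarith [harmonic_floor_le_one_add_log t ht1]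
  · refine IsBigO.of_bound 1 (eventually_atTop.2 ⟨1, fun t ht => ?_⟩)
    have hlog : 0 ≤ Real.log t := Real.log_nonneg ht
    have hle := log_le_harmonic_floor t (by linarith)
    rwa [zetaSum_one, Real.norm_of_nonneg hlog, Real.norm_of_nonneg (hlog.trans hle), one_mul]

theorem rpow_le_zetaSum {e : ℝ} (he : 0 ≤ e) {N : ℕ} (hN : N ≠ 0) :
    (N : ℝ) ^ (1 - e) ≤ zetaSum e N := by
  calc (N : ℝ) ^ (1 - e) = ∑ _k ∈ Finset.range N, (N : ℝ) ^ (-e) := by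
        rw [Finset.sum_const, Finset.card_range, nsmul_eq_mul, sub_eq_add_neg,
          Real.rpow_add (by positivity), Real.rpow_one]
    _ ≤ zetaSum e N := Finset.sum_le_sum fun k hk =>
        Real.rpow_le_rpow_of_nonpos (by positivity)
          (by exact_mod_cast Finset.mem_range.1 hk) (neg_nonpos.2 he)

theorem zetaSum_isTheta_rpow {e : ℝ} (he0 : 0 ≤ e) (he1 : e < 1) :
    (fun t : ℝ => zetaSum e ⌊t⌋₊) =Θ[atTop] fun t : ℝ => t ^ (1 - e) := by
  have hnat : (fun N : ℕ => zetaSum e N) =Θ[atTop] fun N : ℕ => (N : ℝ) ^ (1 - e) := by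
    have hzeta (N : ℕ) : 0 ≤ zetaSum e N := Finset.sum_nonneg fun k _ => by positivity
    obtain ⟨C, _, hle⟩ := exists_sum_rpow_sub_one_le (sub_pos.2 he1)
    refine ⟨IsBigO.of_bound C (.of_forall fun N => ?_),
      IsBigO.of_bound 1 ((eventually_ne_atTop 0).mono fun N hN => ?_)⟩
    · rw [Real.norm_of_nonneg (hzeta N), Real.norm_of_nonneg (by positivity), zetaSum,
        ← sub_sub_cancel_left 1 e]
      exact hle N
    · rw [Real.norm_of_nonneg (hzeta N), Real.norm_of_nonneg (by positivity), one_mul]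
      exact rpow_le_zetaSum he0 hN
  have hfloor : (fun t : ℝ => (⌊t⌋₊ : ℝ)) =Θ[atTop] fun t : ℝ => t := isEquivalent_nat_floor.isTheta
  exact IsTheta.trans ⟨hnat.1.comp_tendsto tendsto_nat_floor_atTop,
    hnat.2.comp_tendsto tendsto_nat_floor_atTop⟩
    (hfloor.rpow (.of_forall fun t => Nat.cast_nonneg _) (eventually_ge_atTop 0))

theorem log_one_add_mul_rpow_isTheta {c p : ℝ} (hc : 0 < c) (hp : 0 < p) :
    (fun t : ℝ => Real.log (1 + c * t ^ p)) =Θ[atTop] Real.log := by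
  have hpow : Tendsto (fun t : ℝ => c * t ^ p) atTop atTop :=
    (tendsto_rpow_atTop hp).const_mul_atTop hc
  have hone : (fun t : ℝ => 1 + c * t ^ p) ~[atTop] fun t => c * t ^ p :=
    (isLittleO_const_left.2 (.inr (tendsto_norm_atTop_atTop.comp hpow))).add_isEquivalent .refl
  have hlog : (fun t => Real.log (c * t ^ p)) =ᶠ[atTop] fun t => Real.log c + p * Real.log t := by
    filter_upwards [eventually_gt_atTop 0] with t ht
    rw [Real.log_mul hc.ne' (by positivity), Real.log_rpow ht]
  have hconst : (fun _ => Real.log c) =o[atTop] fun t => p * Real.log t :=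
    isLittleO_const_left.2 (.inr (tendsto_norm_atTop_atTop.comp
      (Real.tendsto_log_atTop.const_mul_atTop hp)))
  calc (fun t : ℝ => Real.log (1 + c * t ^ p))
      =Θ[atTop] fun t => Real.log (c * t ^ p) := (hone.log hpow).isTheta
    _ =Θ[atTop] fun t => p * Real.log t :=
        (hlog.trans_isEquivalent (hconst.add_isEquivalent .refl)).isTheta
    _ =Θ[atTop] Real.log := (isTheta_refl _ _).const_mul_left hp.ne'

theorem triangleMeasure_isTheta_of_lt (hr : 1 < r) (hα0 : 0 < α) (hα : α < 1 - 1 / r) :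
    (fun t => (triangleMeasure r α).real (Set.Iic t)) =Θ[atTop] fun t => t ^ ((r - 1) / α) := by
  have he : 1 < (1 - α) * ((r - 1) / α) := by
    rw [lt_sub_iff_add_lt, ← lt_sub_iff_add_lt', div_lt_iff₀ (by linarith)] at hα
    rw [← mul_div_assoc, one_lt_div hα0]
    linarith
  have hα1 : α ≤ 1 := hα.le.trans (sub_le_self _ (by positivity))
  simpa only [mul_one] using (triangleMeasure_isTheta hr hα0 hα1).trans
    ((isTheta_refl _ _).mul (zetaSum_isTheta_one he))

theorem triangleMeasure_isTheta_of_eq (hr : 1 < r) (hα : α = 1 - 1 / r) :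
    (fun t => (triangleMeasure r α).real (Set.Iic t)) =Θ[atTop] fun t => t ^ r * Real.log t := by
  have hr0 : 0 < r := by linarith
  have hα0 : 0 < α := by rw [hα, sub_pos, div_lt_one hr0]; exact hr
  have hα1 : α ≤ 1 := hα.le.trans (sub_le_self _ (by positivity))
  have hκ : (r - 1) / α = r := by rw [div_eq_iff hα0.ne', hα]; field_simp
  have he : (1 - α) * r = 1 := by rw [hα]; field_simp; ring
  have hΘ := triangleMeasure_isTheta hr hα0 hα1
  rw [hκ, he] at hΘ
  exact hΘ.trans ((isTheta_refl _ _).mul zetaSum_one_isTheta_log)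

theorem triangleMeasure_isTheta_of_gt (hr : 1 < r) (hα0 : 0 < α) (hα1 : α ≤ 1)
    (hα : 1 - 1 / r < α) :
    (fun t => (triangleMeasure r α).real (Set.Iic t)) =Θ[atTop] fun t => t ^ r := by
  set κ := (r - 1) / α with hκ
  have he0 : 0 ≤ (1 - α) * κ :=
    mul_nonneg (sub_nonneg.2 hα1) (div_nonneg (sub_nonneg.2 hr.le) hα0.le)
  have he1 : (1 - α) * κ < 1 := by
    rw [sub_lt_iff_lt_add, ← sub_lt_iff_lt_add', lt_div_iff₀ (by linarith)] at hα
    rw [hκ, ← mul_div_assoc, div_lt_one hα0]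
    linarith
  have hexp : κ + (1 - (1 - α) * κ) = r := by rw [hκ]; field_simp; ring
  have hpow : (fun t : ℝ => t ^ κ * t ^ (1 - (1 - α) * κ)) =ᶠ[atTop] fun t => t ^ r := by
    filter_upwards [eventually_gt_atTop 0] with t ht
    rw [← Real.rpow_add ht, hexp]
  exact ((triangleMeasure_isTheta hr hα0 hα1).trans
    ((isTheta_refl _ _).mul (zetaSum_isTheta_rpow he0 he1))).trans_eventuallyEq hpow

end TriangleCount

namespace SublinearExpectationSpace

open Asymptotics Filter

variable {Ω : Type*} [MeasurableSpace Ω] {S : SublinearExpectationSpace Ω} {X : Ω → ℝ}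
  {r p α c : ℝ}

/-- The series `∑_{k ≤ n} (n+1)^(r-2) V(|X| > c ((n+1)^α (k+1)^(1-α))^p)` over the triangle
`k ≤ n`, which mediates between the Choquet integrals and the maximal weighted sums. -/
noncomputable def triangleSum (S : SublinearExpectationSpace Ω) (X : Ω → ℝ) (r p α c : ℝ) :
    ℝ≥0∞ :=
  ∑' i, triangleWeight r i * ENNReal.ofReal (S.prob {ω | c * triangleThreshold α i ^ p < |X ω|})

theorem choquet_lt_top_iff {Z : Ω → ℝ} (hZ : Measurable Z) (hZ0 : ∀ ω, 0 ≤ Z ω) :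
    S.choquet Z < ⊤ ↔ ∫⁻ x in Set.Ioi 0, ENNReal.ofReal (S.prob {ω | x < Z ω}) < ⊤ := by
  have hmeas (x : ℝ) : MeasurableSet {ω | x < Z ω} := measurableSet_lt measurable_const hZ
  have hneg : ∫⁻ x in Set.Iio (0 : ℝ), (1 - S.capacity {ω | x < Z ω}) = 0 :=
    MeasureTheory.setLIntegral_eq_zero measurableSet_Iio fun x hx => by
      have huniv : {ω | x < Z ω} = Set.univ :=
        Set.eq_univ_of_forall fun ω => (Set.mem_Iio.1 hx).trans_le (hZ0 ω)
      simp only [huniv, capacity_eq_ofReal_prob MeasurableSet.univ, prob_univ,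
        ENNReal.ofReal_one, tsub_self, Pi.zero_apply]
  rw [choquet, hneg, EReal.coe_ennreal_zero, sub_zero, lt_top_iff_ne_top, lt_top_iff_ne_top, ne_eq,
    EReal.coe_ennreal_eq_top_iff]
  simp only [capacity_eq_ofReal_prob (hmeas _)]

theorem prob_lt_antitone {Z : Ω → ℝ} (hZ : Measurable Z) :
    Antitone fun x => S.prob {ω | x < Z ω} := fun _ _ hxy =>
  prob_mono (measurableSet_lt measurable_const hZ) (measurableSet_lt measurable_const hZ)
    fun _ hω => hxy.trans_lt hω

theorem choquet_comp_abs_lt_top_iff (hX : Measurable X) (hα : 0 < α) (hp : 0 < p) (hc : 0 < c)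
    {φ : ℝ → ℝ} (hφmono : StrictMonoOn φ (Set.Ici 0)) (hφcont : ContinuousOn φ (Set.Ici 0))
    (hφ0 : φ 0 = 0) (hφtop : Tendsto φ atTop atTop)
    (hΘ : (fun t => (triangleMeasure r α).real (Set.Iic t)) =Θ[atTop] fun t => φ (c * t ^ p)) :
    S.choquet (fun ω => φ |X ω|) < ⊤ ↔ S.triangleSum X r p α c < ⊤ := by
  have hφnonneg {x : ℝ} (hx : 0 ≤ x) : 0 ≤ φ x :=
    hφ0.ge.trans (hφmono.monotoneOn Set.self_mem_Ici hx hx)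
  have hmeas : Measurable fun ω => φ |X ω| :=
    (hφcont.comp_continuous continuous_abs abs_nonneg).measurable.comp hX
  have hlevel (x : ℝ) : MeasurableSet {ω | x < φ |X ω|} := measurableSet_lt measurable_const hmeas
  have hscale {t : ℝ} (ht : 0 ≤ t) : 0 ≤ c * t ^ p := by positivity
  have hψmono : StrictMonoOn (fun t => φ (c * t ^ p)) (Set.Ici 0) := fun s hs t ht hst =>
    hφmono (hscale hs) (hscale ht)
      (mul_lt_mul_of_pos_left (Real.rpow_lt_rpow hs hst hp) hc)
  have hψsurj : Set.SurjOn (fun t => φ (c * t ^ p)) (Set.Ici 0) (Set.Ici 0) := by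
    have hcont : ContinuousOn (fun t => φ (c * t ^ p)) (Set.Ici 0) :=
      hφcont.comp (continuous_const.mul (Real.continuous_rpow_const hp.le)).continuousOn
        fun t ht => hscale ht
    have htop : Tendsto (fun t => φ (c * t ^ p)) atTop atTop :=
      hφtop.comp ((tendsto_rpow_atTop hp).const_mul_atTop hc)
    simpa only [Set.SurjOn, Real.zero_rpow hp.ne', mul_zero, hφ0] using
      isPreconnected_Ici.intermediate_value_Ici Set.self_mem_Ici
        (le_principal_iff.2 (Ici_mem_atTop 0)) hcont htop
  have hτ (i : ℕ × ℕ) : 0 ≤ triangleThreshold α i := by unfold triangleThreshold; positivity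
  rw [choquet_lt_top_iff hmeas fun ω => hφnonneg (abs_nonneg _),
    lintegral_lt_top_iff_tsum_lt_top (prob_lt_antitone hmeas) (fun x => prob_nonneg (hlevel x))
      (fun x => prob_le_one (hlevel x)) hτ hψmono (fun t ht => hφnonneg (hscale ht)) hψsurj
      (fun t => triangleMeasure_Iic_ne_top hα t) hΘ]
  have hlt (i : ℕ × ℕ) (ω : Ω) : φ (c * triangleThreshold α i ^ p) < φ |X ω| ↔
      c * triangleThreshold α i ^ p < |X ω| :=
    hφmono.lt_iff_lt (hscale (hτ i)) (abs_nonneg (X ω))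
  simp only [hlt, triangleSum]

theorem choquet_rpow_abs_lt_top_iff (hX : Measurable X) (hα : 0 < α) (hp : 0 < p) (hc : 0 < c)
    {β : ℝ} (hβ : 0 < β)
    (hΘ : (fun t => (triangleMeasure r α).real (Set.Iic t)) =Θ[atTop] fun t => t ^ (p * β)) :
    S.choquet (fun ω => |X ω| ^ β) < ⊤ ↔ S.triangleSum X r p α c < ⊤ := by
  have hpow : (fun t : ℝ => c ^ β * t ^ (p * β)) =ᶠ[atTop] fun t => (c * t ^ p) ^ β := by
    filter_upwards [eventually_ge_atTop 0] with t ht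
    rw [Real.mul_rpow hc.le (by positivity), ← Real.rpow_mul ht]
  exact choquet_comp_abs_lt_top_iff hX hα hp hc (φ := fun x => x ^ β)
    (Real.strictMonoOn_rpow_Ici_of_exponent_pos hβ)
    (Real.continuous_rpow_const hβ.le).continuousOn (Real.zero_rpow hβ.ne')
    (tendsto_rpow_atTop hβ)
    ((hΘ.trans ((isTheta_refl _ _).const_mul_right (by positivity))).trans_eventuallyEq hpow)

theorem choquet_rpow_abs_mul_log_lt_top_iff (hX : Measurable X) (hα : 0 < α) (hp : 0 < p)
    (hc : 0 < c) (hr : 0 < r)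
    (hΘ : (fun t => (triangleMeasure r α).real (Set.Iic t)) =Θ[atTop]
      fun t => t ^ r * Real.log t) :
    S.choquet (fun ω => |X ω| ^ (r / p) * Real.log (1 + |X ω|)) < ⊤ ↔
      S.triangleSum X r p α c < ⊤ := by
  have hβ : 0 < r / p := div_pos hr hp
  have hone {x : ℝ} (hx : x ∈ Set.Ici (0 : ℝ)) : 0 < 1 + x :=
    add_pos_of_pos_of_nonneg one_pos hx
  have hlog {x : ℝ} (hx : x ∈ Set.Ici (0 : ℝ)) : 0 ≤ Real.log (1 + x) :=
    Real.log_nonneg (le_add_of_nonneg_right hx)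
  have hpow : (fun t : ℝ => c ^ (r / p) * t ^ r) =ᶠ[atTop] fun t => (c * t ^ p) ^ (r / p) := by
    filter_upwards [eventually_ge_atTop 0] with t ht
    rw [Real.mul_rpow hc.le (by positivity), ← Real.rpow_mul ht, mul_div_cancel₀ _ hp.ne']
  refine choquet_comp_abs_lt_top_iff hX hα hp hc
    (φ := fun x => x ^ (r / p) * Real.log (1 + x)) ?_ ?_ ?_ ?_ ?_
  · exact fun x hx _ _ hxy => mul_lt_mul'' (Real.rpow_lt_rpow hx hxy hβ)
      (Real.log_lt_log (hone hx) (by gcongr)) (Real.rpow_nonneg hx _) (hlog hx)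
  · exact (Real.continuous_rpow_const hβ.le).continuousOn.mul
      ((continuous_const.add continuous_id).continuousOn.log fun x hx => (hone hx).ne')
  · rw [Real.zero_rpow hβ.ne', zero_mul]
  · exact (tendsto_rpow_atTop hβ).atTop_mul_atTop₀
      (Real.tendsto_log_atTop.comp (tendsto_atTop_add_const_left _ _ tendsto_id))
  · exact hΘ.trans ((((isTheta_refl _ _).const_mul_right (by positivity)).trans_eventuallyEq
      hpow).mul (log_one_add_mul_rpow_isTheta hc hp).symm)

theorem choquet_conditions_iff (hX : Measurable X) (hr : 1 < r) (hp : 0 < p) (hα0 : 0 < α)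
    (hα1 : α ≤ 1) (hc : 0 < c) :
    ((α < 1 - 1 / r → S.choquet (fun ω => |X ω| ^ ((r - 1) / (p * α))) < ⊤) ∧
      (α = 1 - 1 / r → S.choquet (fun ω => |X ω| ^ (r / p) * Real.log (1 + |X ω|)) < ⊤) ∧
      (1 - 1 / r < α → S.choquet (fun ω => |X ω| ^ (r / p)) < ⊤)) ↔
    S.triangleSum X r p α c < ⊤ := by
  have hr0 : 0 < r := one_pos.trans hr
  rcases lt_trichotomy α (1 - 1 / r) with hα | hα | hα
  · have hexp : p * ((r - 1) / (p * α)) = (r - 1) / α := by field_simp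
    simp only [hα, hα.ne, hα.not_gt, forall_const, false_imp_iff, and_true]
    refine choquet_rpow_abs_lt_top_iff hX hα0 hp hc
      (div_pos (sub_pos.2 hr) (mul_pos hp hα0)) ?_
    rw [hexp]
    exact triangleMeasure_isTheta_of_lt hr hα0 hα
  · have hlt : ¬ α < 1 - 1 / r := hα.not_lt
    have hgt : ¬ 1 - 1 / r < α := hα.not_gt
    simp only [hlt, hgt, eq_true hα, forall_const, false_imp_iff, and_true, true_and]
    exact choquet_rpow_abs_mul_log_lt_top_iff hX hα0 hp hc hr0 (triangleMeasure_isTheta_of_eq hr hα)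
  · simp only [hα, hα.ne', hα.not_gt, forall_const, false_imp_iff, true_and]
    refine choquet_rpow_abs_lt_top_iff hX hα0 hp hc (div_pos hr0 hp) ?_
    rw [mul_div_cancel₀ _ hp.ne']
    exact triangleMeasure_isTheta_of_gt hr hα0 hα1 hα

end SublinearExpectationSpace

/-! ### Exponential inequality -/

section Truncation

/-- Truncation of `x` to the interval `[-δ, δ]`. -/
noncomputable def clamp (δ x : ℝ) : ℝ := max (-δ) (min x δ)

variable {δ q : ℝ}

theorem clamp_of_abs_le {x : ℝ} (h : |x| ≤ δ) : clamp δ x = x := by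
  rw [clamp, min_eq_left (abs_le.1 h).2, max_eq_right (abs_le.1 h).1]

theorem clamp_le (hδ : 0 ≤ δ) (x : ℝ) : clamp δ x ≤ δ :=
  max_le (neg_le_self hδ) (min_le_right _ _)

theorem abs_clamp_le_min (hδ : 0 ≤ δ) (x : ℝ) : |clamp δ x| ≤ min |x| δ := by
  refine le_min ?_ (abs_le.2 ⟨le_max_left _ _, clamp_le hδ x⟩)
  rcases le_total |x| δ with hx | hx
  · rw [clamp_of_abs_le hx]
  · exact (abs_le.2 ⟨le_max_left _ _, clamp_le hδ x⟩).trans hx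

theorem lipschitzWith_clamp (δ : ℝ) : LipschitzWith 1 (clamp δ) :=
  (LipschitzWith.id.min_const δ).const_max (-δ)

theorem abs_clamp_rpow_le (hδ : 0 < δ) (hq : 0 ≤ q) {e : ℝ} (hqe : q ≤ e) (x : ℝ) :
    |clamp δ x| ^ e ≤ δ ^ (e - q) * |x| ^ q := by
  have hle := le_min_iff.1 (abs_clamp_le_min hδ.le x)
  have hpos : 0 ≤ |clamp δ x| := abs_nonneg _
  calc |clamp δ x| ^ e = |clamp δ x| ^ (e - q) * |clamp δ x| ^ q := by
        rw [← Real.rpow_add_of_nonneg hpos (sub_nonneg.2 hqe) hq, sub_add_cancel]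
    _ ≤ δ ^ (e - q) * |x| ^ q := by
        exact mul_le_mul (Real.rpow_le_rpow hpos hle.2 (sub_nonneg.2 hqe))
          (Real.rpow_le_rpow hpos hle.1 hq) (by positivity) (by positivity)

theorem exists_clamp_le (hδ : 0 < δ) (hq : 0 ≤ q) :
    ∃ m : ℝ, 0 ≤ m ∧ ∀ x, clamp δ x ≤ m * x + δ ^ (1 - q) * |x| ^ q := by
  rcases le_or_gt q 1 with hq1 | hq1
  · refine ⟨0, le_rfl, fun x => ?_⟩
    simpa using (le_abs_self _).trans (by simpa using abs_clamp_rpow_le hδ hq hq1 x)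
  · refine ⟨1, zero_le_one, fun x => ?_⟩
    rw [one_mul]
    have hpos : 0 ≤ δ ^ (1 - q) * |x| ^ q := by positivity
    rcases le_or_gt |x| δ with hx | hx
    · rw [clamp_of_abs_le hx]
      exact le_add_of_nonneg_right hpos
    · have habs : |x| ≤ δ ^ (1 - q) * |x| ^ q :=
        calc |x| = |x| ^ (1 - q) * |x| ^ q := by
              rw [← Real.rpow_add (hδ.trans hx), sub_add_cancel, Real.rpow_one]
          _ ≤ δ ^ (1 - q) * |x| ^ q := by
              gcongr ?_ * _
              exact Real.rpow_le_rpow_of_nonpos hδ hx.le (by linarith)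
      have hx0 : x ≤ x + δ ^ (1 - q) * |x| ^ q := le_add_of_nonneg_right hpos
      exact max_le (by linarith [neg_abs_le x]) ((min_le_left _ _).trans hx0)

theorem exp_le_one_add_self_add_sq_mul_exp_abs (x : ℝ) :
    Real.exp x ≤ 1 + x + x ^ 2 * Real.exp |x| := by
  have h := Complex.norm_exp_sub_sum_le_norm_mul_exp (x : ℂ) 2
  have hsum : Complex.exp x - ∑ m ∈ Finset.range 2, (x : ℂ) ^ m / (m.factorial : ℂ) =
      ((Real.exp x - (1 + x) : ℝ) : ℂ) := by
    simp [Finset.sum_range_succ]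
  rw [hsum, Complex.norm_real, Complex.norm_real, Real.norm_eq_abs, Real.norm_eq_abs, sq_abs] at h
  linarith [le_abs_self (Real.exp x - (1 + x))]

/-- Coefficient of the `q`-th absolute moment in the bound for the Laplace transform at `t` of a
variable truncated at `δ`. -/
noncomputable def clampConst (q δ t : ℝ) : ℝ :=
  t * δ ^ (1 - q) + t ^ 2 * Real.exp (t * δ) * δ ^ (2 - q)

theorem clampConst_nonneg {t : ℝ} (hδ : 0 ≤ δ) (ht : 0 ≤ t) : 0 ≤ clampConst q δ t := by
  unfold clampConst
  positivity

theorem exp_mul_clamp_le {t : ℝ} (hδ : 0 < δ) (ht : 0 ≤ t) (hq0 : 0 ≤ q) (hq2 : q ≤ 2) {x y : ℝ}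
    (hxy : clamp δ x ≤ y + δ ^ (1 - q) * |x| ^ q) :
    Real.exp (t * clamp δ x) ≤ 1 + t * y + clampConst q δ t * |x| ^ q := by
  have habs : |t * clamp δ x| ≤ t * δ := by
    rw [abs_mul, abs_of_nonneg ht]
    exact mul_le_mul_of_nonneg_left ((abs_clamp_le_min hδ.le x).trans (min_le_right _ _)) ht
  have hsq : (clamp δ x) ^ 2 ≤ δ ^ (2 - q) * |x| ^ q := by
    simpa using abs_clamp_rpow_le hδ hq0 hq2 x
  calc Real.exp (t * clamp δ x)
      ≤ 1 + t * clamp δ x + (t * clamp δ x) ^ 2 * Real.exp |t * clamp δ x| :=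
        exp_le_one_add_self_add_sq_mul_exp_abs _
    _ ≤ 1 + t * (y + δ ^ (1 - q) * |x| ^ q) +
          t ^ 2 * (δ ^ (2 - q) * |x| ^ q) * Real.exp (t * δ) := by
        rw [mul_pow]
        gcongr
    _ = 1 + t * y + clampConst q δ t * |x| ^ q := by
        unfold clampConst
        ring

theorem exists_clampConst_mul_log_le {κ η : ℝ} (hδ : 0 ≤ δ) (hκ : 0 ≤ κ) (hη : κ * δ < η) :
    ∃ M : ℝ, 0 ≤ M ∧ ∀ x, 1 ≤ x → clampConst q δ (κ * Real.log x) ≤ M * x ^ η := by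
  have hη0 : 0 < η := (mul_nonneg hκ hδ).trans_lt hη
  set θ := (η - κ * δ) / 2 with hθ
  have hθ0 : 0 < θ := half_pos (sub_pos.2 hη)
  refine ⟨κ / η * δ ^ (1 - q) + (κ / θ) ^ 2 * δ ^ (2 - q), by positivity, fun x hx => ?_⟩
  have hx0 : 0 < x := one_pos.trans_le hx
  have hlog : κ * Real.log x ≤ κ / η * x ^ η :=
    (mul_le_mul_of_nonneg_left (Real.log_le_rpow_div hx0.le hη0) hκ).trans_eq (by ring)
  have hsq : (κ * Real.log x) ^ 2 ≤ (κ / θ * x ^ θ) ^ 2 :=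
    pow_le_pow_left₀ (mul_nonneg hκ (Real.log_nonneg hx))
      ((mul_le_mul_of_nonneg_left (Real.log_le_rpow_div hx0.le hθ0) hκ).trans_eq (by ring)) 2
  have hexp : Real.exp (κ * Real.log x * δ) = x ^ (κ * δ) := by
    rw [Real.rpow_def_of_pos hx0]
    ring_nf
  have hpow : (x ^ θ) ^ 2 * x ^ (κ * δ) = x ^ η := by
    rw [← Real.rpow_natCast, ← Real.rpow_mul hx0.le, ← Real.rpow_add hx0, hθ]
    congr 1
    push_cast
    ring
  calc clampConst q δ (κ * Real.log x)
      ≤ κ / η * x ^ η * δ ^ (1 - q) + (κ / θ * x ^ θ) ^ 2 * x ^ (κ * δ) * δ ^ (2 - q) := by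
        rw [clampConst, hexp]
        gcongr
    _ = (κ / η * δ ^ (1 - q) + (κ / θ) ^ 2 * δ ^ (2 - q)) * x ^ η := by
        rw [← hpow]
        ring

end Truncation

theorem lipschitzOnWith_exp_Iic (M : ℝ) :
    LipschitzOnWith (Real.exp M).toNNReal Real.exp (Set.Iic M) :=
  (convex_Iic M).lipschitzOnWith_of_nnnorm_deriv_le (fun _ _ => Real.differentiableAt_exp)
    fun x hx => by
      rw [Real.deriv_exp, ← NNReal.coe_le_coe, coe_nnnorm, Real.norm_eq_abs, Real.abs_exp,
        Real.coe_toNNReal _ (Real.exp_pos M).le]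
      exact Real.exp_le_exp.2 hx

theorem lipschitzWith_max_one_rpow {s : ℝ} (hs0 : 0 ≤ s) (hs1 : s ≤ 1) :
    LipschitzWith 1 fun x : ℝ => max x 1 ^ s := by
  have hmono {a b : ℝ} (hb : 1 ≤ b) (hab : b ≤ a) : b - b ^ s ≤ a - a ^ s := by
    have hfactor {y : ℝ} (hy : 1 ≤ y) : y - y ^ s = y ^ s * (y ^ (1 - s) - 1) := by
      rw [mul_sub_one, ← Real.rpow_add (by linarith), add_sub_cancel, Real.rpow_one]
    rw [hfactor hb, hfactor (hb.trans hab)]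
    have hs := sub_nonneg.2 hs1
    exact mul_le_mul (Real.rpow_le_rpow (by linarith) hab hs0)
      (sub_le_sub_right (Real.rpow_le_rpow (by linarith) hab hs) 1)
      (sub_nonneg.2 (Real.one_le_rpow hb hs)) (Real.rpow_nonneg (by linarith) s)
  refine LipschitzWith.of_le_add fun x y => ?_
  rcases le_total (max x 1) (max y 1) with h | h
  · exact (Real.rpow_le_rpow (by positivity) h hs0).trans (le_add_of_nonneg_right dist_nonneg)
  · have hdist : max x 1 - max y 1 ≤ dist x y :=
      (le_abs_self _).trans ((abs_max_sub_max_le_max x 1 y 1).trans_eq (by simp [Real.dist_eq]))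
    linarith [hmono (le_max_right y 1) h]

/-- The function `max (|x|, 1) ^ q`, used in place of `|x| ^ q` because the latter is not locally
Lipschitz at `0` when `q < 1`, so that `|X| ^ q` need not be an admissible random variable. -/
noncomputable def momentFun (q x : ℝ) : ℝ := max |x| 1 ^ q

theorem momentFun_nonneg (q x : ℝ) : 0 ≤ momentFun q x := by
  unfold momentFun
  positivity

theorem abs_rpow_le_momentFun {q : ℝ} (hq : 0 ≤ q) (x : ℝ) : |x| ^ q ≤ momentFun q x :=
  Real.rpow_le_rpow (abs_nonneg x) (le_max_left _ _) hq

theorem momentFun_eq_max_sq_one_rpow (q x : ℝ) :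
    momentFun q x = max (x * x) 1 ^ (q / 2) := by
  have hsq : max (x * x) 1 = max |x| 1 ^ (2 : ℝ) := by
    rw [Real.rpow_two, ← abs_mul_abs_self, ← sq]
    rcases le_total |x| 1 with hx | hx
    · rw [max_eq_right hx, max_eq_right (pow_le_one₀ (abs_nonneg x) hx), one_pow]
    · rw [max_eq_left hx, max_eq_left (one_le_pow₀ hx)]
  rw [hsq, ← Real.rpow_mul (by positivity), mul_div_cancel₀ q two_ne_zero, momentFun]

namespace SublinearExpectationSpace

variable {Ω : Type*} [MeasurableSpace Ω] {S : SublinearExpectationSpace Ω}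

theorem momentFun_mem {Z : Ω → ℝ} (hZ : Z ∈ S.H) {q : ℝ} (hq0 : 0 ≤ q) (hq2 : q ≤ 2) :
    (fun ω => momentFun q (Z ω)) ∈ S.H := by
  simpa only [momentFun_eq_max_sq_one_rpow] using lipschitz_comp_mem
    (lipschitzWith_max_one_rpow (by positivity) (by linarith : q / 2 ≤ 1)) (mul_mem hZ hZ)

theorem exp_mul_clamp_mem {Z : Ω → ℝ} (hZ : Z ∈ S.H) {t δ : ℝ} (ht : 0 ≤ t) (hδ : 0 ≤ δ) :
    (fun ω => Real.exp (t * clamp δ (Z ω))) ∈ S.H := by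
  have hmaps : Set.MapsTo (fun x => t * clamp δ x) Set.univ (Set.Iic (t * δ)) :=
    fun x _ => mul_le_mul_of_nonneg_left (clamp_le hδ x) ht
  have hlip : LipschitzOnWith (‖t‖₊ * 1) (fun x => t * clamp δ x) Set.univ :=
    ((lipschitzWith_smul t).comp (lipschitzWith_clamp δ)).lipschitzOnWith
  exact lipschitz_comp_mem (φ := Real.exp ∘ fun x => t * clamp δ x)
    (lipschitzOnWith_univ.1 ((lipschitzOnWith_exp_Iic (t * δ)).comp hlip hmaps)) hZ

theorem E_exp_mul_clamp_le {Z : Ω → ℝ} (hZ : Z ∈ S.H) {t δ q K a : ℝ} (ht : 0 ≤ t) (hδ : 0 < δ)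
    (hq0 : 0 ≤ q) (hq2 : q ≤ 2) (hK : S.E (fun ω => momentFun q (Z ω)) ≤ K)
    (ha : S.E (fun ω => a * Z ω) ≤ 0) :
    S.E (fun ω => Real.exp (t * clamp δ (a * Z ω))) ≤
      ((1 + clampConst q δ t * |a| ^ q * K : ℝ) : EReal) := by
  obtain ⟨m, hm0, hm⟩ := exists_clamp_le hδ hq0
  have hD : 0 ≤ clampConst q δ t := clampConst_nonneg hδ.le ht
  have haZ := const_mul_mem a hZ
  have hlin_mem := const_mul_mem (t * m) haZ
  have hmom_mem := const_mul_mem (clampConst q δ t * |a| ^ q) (momentFun_mem hZ hq0 hq2)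
  have hlin : S.E (fun ω => t * m * (a * Z ω)) ≤ ((t * m * 0 : ℝ) : EReal) :=
    E_const_mul_le haZ (by positivity) (by exact_mod_cast ha)
  have hmom := E_const_mul_le (momentFun_mem hZ hq0 hq2)
    (by positivity : 0 ≤ clampConst q δ t * |a| ^ q) hK
  have hone_mem := add_mem (S.const_mem 1) hlin_mem
  have hpointwise (ω : Ω) : Real.exp (t * clamp δ (a * Z ω)) ≤
      1 + t * m * (a * Z ω) + clampConst q δ t * |a| ^ q * momentFun q (Z ω) :=
    calc Real.exp (t * clamp δ (a * Z ω))
        ≤ 1 + t * (m * (a * Z ω)) + clampConst q δ t * |a * Z ω| ^ q :=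
          exp_mul_clamp_le hδ ht hq0 hq2 (hm _)
      _ = 1 + t * m * (a * Z ω) + clampConst q δ t * |a| ^ q * |Z ω| ^ q := by
          rw [abs_mul, Real.mul_rpow (abs_nonneg _) (abs_nonneg _)]
          ring
      _ ≤ _ := by
          gcongr
          exact abs_rpow_le_momentFun hq0 _
  refine (S.mono _ (add_mem hone_mem hmom_mem) _ (exp_mul_clamp_mem haZ ht hδ.le)
    hpointwise).trans ?_
  simpa using E_add_le hone_mem hmom_mem (E_add_le (S.const_mem 1) hlin_mem (S.const 1).le hlin)
    hmom

/-- The variable `X 0` need not have mean zero (its truncation is bounded by `δ` instead), which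
costs the factor `exp (t * δ)`. -/
theorem prob_lt_sum_clamp_le {X : ℕ → Ω → ℝ} (hX : ∀ i, X i ∈ S.H) (hind : S.IndepSeq X)
    {t δ q K : ℝ} (ht : 0 ≤ t) (hδ : 0 < δ) (hq0 : 0 ≤ q) (hq2 : q ≤ 2) (hK0 : 0 ≤ K)
    (hK : ∀ i, S.E (fun ω => momentFun q (X i ω)) ≤ K) {a : ℕ → ℝ}
    (ha : ∀ i, 1 ≤ i → S.E (fun ω => a i * X i ω) ≤ 0) (ε : ℝ) (n : ℕ) :
    S.prob {ω | ε < ∑ i ∈ Finset.range (n + 1), clamp δ (a i * X i ω)} ≤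
      Real.exp (-(t * ε)) * (Real.exp (t * δ) *
        Real.exp (clampConst q δ t * K * ∑ i ∈ Finset.range (n + 1), |a i| ^ q)) := by
  have hD : 0 ≤ clampConst q δ t := clampConst_nonneg hδ.le ht
  have hclamp : Measurable (clamp δ) := (lipschitzWith_clamp δ).continuous.measurable
  have hXm (i : ℕ) : Measurable (X i) := S.measurable_of_mem _ (hX i)
  have hexp_le (i : ℕ) (y : ℝ) : Real.exp (t * clamp δ (a i * y)) ≤ Real.exp (t * δ) :=
    Real.exp_le_exp.2 (mul_le_mul_of_nonneg_left (clamp_le hδ.le _) ht)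
  have hmem (i : ℕ) : (fun ω => Real.exp (t * clamp δ (a i * X i ω))) ∈ S.H :=
    exp_mul_clamp_mem (const_mul_mem _ (hX i)) ht hδ.le
  have hE (i : ℕ) : S.E (fun ω => Real.exp (t * clamp δ (a i * X i ω))) ≤
      (Real.exp ((if i = 0 then t * δ else 0) + clampConst q δ t * K * |a i| ^ q) : ℝ) := by
    rcases Nat.eq_zero_or_pos i with rfl | hi
    · refine (E_le_of_forall_le (hmem 0) fun ω => hexp_le 0 (X 0 ω)).trans ?_
      rw [EReal.coe_le_coe_iff, if_pos rfl]
      exact Real.exp_le_exp.2 (le_add_of_nonneg_right (by positivity))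
    · refine (E_exp_mul_clamp_le (hX i) ht hδ hq0 hq2 (hK i) (ha i hi)).trans ?_
      rw [EReal.coe_le_coe_iff, if_neg hi.ne', zero_add]
      linarith [Real.add_one_le_exp (clampConst q δ t * K * |a i| ^ q)]
  have hprod : S.E (fun ω => ∏ i ∈ Finset.range (n + 1), Real.exp (t * clamp δ (a i * X i ω))) ≤
      (Real.exp (t * δ) *
        Real.exp (clampConst q δ t * K * ∑ i ∈ Finset.range (n + 1), |a i| ^ q) : ℝ) := by
    refine (hind.E_prod_le (g := fun i y => Real.exp (t * clamp δ (a i * y)))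
      (fun i => by fun_prop) (fun i y => (Real.exp_pos _).le) hexp_le hmem hE n).trans_eq ?_
    rw [← Real.exp_sum, Finset.sum_add_distrib, ← Finset.mul_sum,
      Finset.sum_ite_eq' _ 0 (fun _ => t * δ), if_pos (by simp), Real.exp_add]
  have hmeas : MeasurableSet {ω | ε < ∑ i ∈ Finset.range (n + 1), clamp δ (a i * X i ω)} :=
    measurableSet_lt (by fun_prop) (by fun_prop)
  refine prob_le_of_E_le hmeas (const_mul_mem (Real.exp (-(t * ε))) (prod_mem _ hmem))
    (fun ω => by positivity) (fun ω hω => ?_)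
    (E_const_mul_le (prod_mem _ hmem) (Real.exp_pos _).le hprod)
  rw [← Real.exp_sum, ← Finset.mul_sum, ← Real.exp_add]
  refine Real.one_le_exp ?_
  linarith [mul_le_mul_of_nonneg_left (le_of_lt (Set.mem_ofPred.1 hω)) ht]

end SublinearExpectationSpace

/-! ### Moments and weight sums -/

theorem rpow_sub_rpow_le_mul_rpow_sub_one {r x : ℝ} (hr : 1 ≤ r) (hx : 0 ≤ x) :
    (x + 1) ^ r - x ^ r ≤ r * (x + 1) ^ (r - 1) := by
  have hx1 : 0 < x + 1 := by positivity
  have hbernoulli : 1 + r * (-1 / (x + 1)) ≤ (1 + -1 / (x + 1)) ^ r :=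
    one_add_mul_self_le_rpow_one_add (by rw [le_div_iff₀ hx1]; linarith) hr
  have hratio : 1 + -1 / (x + 1) = x / (x + 1) := by field_simp; ring
  rw [hratio, Real.div_rpow hx hx1.le, le_div_iff₀ (by positivity)] at hbernoulli
  rw [Real.rpow_sub_one hx1.ne']
  linear_combination hbernoulli

theorem rpow_le_one_add_sum_rpow_sub_one {r : ℝ} (hr : 1 ≤ r) (N : ℕ) :
    ((N : ℝ) + 1) ^ r ≤
      1 + ∑ n ∈ Finset.range N, r * 2 ^ (r - 1) * ((n : ℝ) + 1) ^ (r - 1) := by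
  have htelescope := Finset.sum_range_sub (fun n : ℕ => ((n : ℝ) + 1) ^ r) N
  simp only [Nat.cast_zero, zero_add, Real.one_rpow] at htelescope
  rw [← sub_le_iff_le_add', ← htelescope]
  refine Finset.sum_le_sum fun n _ => ?_
  rw [Nat.cast_add_one]
  calc ((n : ℝ) + 1 + 1) ^ r - ((n : ℝ) + 1) ^ r ≤ r * ((n : ℝ) + 1 + 1) ^ (r - 1) :=
        rpow_sub_rpow_le_mul_rpow_sub_one hr (by positivity)
    _ ≤ r * (2 * ((n : ℝ) + 1)) ^ (r - 1) := by
        gcongr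
        linarith [n.cast_nonneg (α := ℝ)]
    _ = r * 2 ^ (r - 1) * ((n : ℝ) + 1) ^ (r - 1) := by
        rw [Real.mul_rpow two_pos.le (by positivity), mul_assoc]

theorem ofReal_momentFun_le {r p q : ℝ} (hr : 1 ≤ r) (hp : 0 < p) (hq : 0 ≤ q) (hpq : p * q ≤ r)
    (x : ℝ) :
    ENNReal.ofReal (momentFun q x) ≤
      1 + ∑' n : ℕ, ENNReal.ofReal (r * 2 ^ (r - 1) * ((n : ℝ) + 1) ^ (r - 1) *
        {y : ℝ | ((n : ℝ) + 1) ^ p < |y|}.indicator (fun _ => 1) x) := by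
  classical
  have hex : ∃ N : ℕ, |x| ≤ ((N : ℝ) + 1) ^ p := by
    obtain ⟨N, hN⟩ := exists_nat_ge (|x| ^ p⁻¹)
    refine ⟨N, ?_⟩
    rw [← Real.rpow_inv_le_iff_of_pos (abs_nonneg _) (by positivity) hp]
    linarith
  set N := Nat.find hex
  have hN1 : (1 : ℝ) ≤ N + 1 := le_add_of_nonneg_left N.cast_nonneg
  have hmoment : momentFun q x ≤ ((N : ℝ) + 1) ^ r :=
    calc momentFun q x ≤ (((N : ℝ) + 1) ^ p) ^ q :=
          Real.rpow_le_rpow (by positivity)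
            (max_le (Nat.find_spec hex) (Real.one_le_rpow hN1 hp.le)) hq
      _ = ((N : ℝ) + 1) ^ (p * q) := by rw [Real.rpow_mul (by positivity)]
      _ ≤ ((N : ℝ) + 1) ^ r := Real.rpow_le_rpow_of_exponent_le hN1 hpq
  have hindicator : ∀ n ∈ Finset.range N, r * 2 ^ (r - 1) * ((n : ℝ) + 1) ^ (r - 1) =
      r * 2 ^ (r - 1) * ((n : ℝ) + 1) ^ (r - 1) *
        {y : ℝ | ((n : ℝ) + 1) ^ p < |y|}.indicator (fun _ => 1) x := fun n hn => by
    have hlt : x ∈ {y : ℝ | ((n : ℝ) + 1) ^ p < |y|} :=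
      not_le.1 (Nat.find_min hex (Finset.mem_range.1 hn))
    rw [Set.indicator_of_mem hlt, mul_one]
  have hnonneg (n : ℕ) : 0 ≤ r * 2 ^ (r - 1) * ((n : ℝ) + 1) ^ (r - 1) *
      {y : ℝ | ((n : ℝ) + 1) ^ p < |y|}.indicator (fun _ => (1 : ℝ)) x :=
    mul_nonneg (by positivity) (indicator_one_nonneg _ _)
  refine (ENNReal.ofReal_le_ofReal (hmoment.trans (rpow_le_one_add_sum_rpow_sub_one hr N))).trans ?_
  rw [Finset.sum_congr rfl hindicator,
    ENNReal.ofReal_add zero_le_one (Finset.sum_nonneg fun n _ => hnonneg n), ENNReal.ofReal_one,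
    ENNReal.ofReal_sum_of_nonneg fun n _ => hnonneg n]
  gcongr
  exact ENNReal.sum_le_tsum _

namespace SublinearExpectationSpace

variable {Ω : Type*} [MeasurableSpace Ω] {S : SublinearExpectationSpace Ω}

section Moments

theorem CountablySubadditive.toENNReal_E_le (hS : S.CountablySubadditive) {Z : Ω → ℝ}
    (hZ : Z ∈ S.H) (hZ0 : ∀ ω, 0 ≤ Z ω) {Y : ℕ → Ω → ℝ} (hY : ∀ n, Y n ∈ S.H)
    (hY0 : ∀ n ω, 0 ≤ Y n ω)
    (hle : ∀ ω, ENNReal.ofReal (Z ω) ≤ 1 + ∑' n, ENNReal.ofReal (Y n ω)) :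
    (S.E Z).toENNReal ≤ 1 + ∑' n, (S.E (Y n)).toENNReal := by
  have h := hS Z hZ (fun n => n.casesOn (fun _ => 1) Y) (fun n => n.casesOn (S.const_mem 1) hY) hZ0
    (fun n => n.casesOn (fun _ => zero_le_one) hY0) fun ω => by
      rw [tsum_eq_zero_add' ENNReal.summable]
      exact (hle ω).trans_eq (congrArg (· + _) ENNReal.ofReal_one.symm)
  have hone : (S.E fun _ => 1).toENNReal = 1 := by
    rw [S.const, EReal.toENNReal_of_ne_top (EReal.coe_ne_top _), EReal.toReal_coe,
      ENNReal.ofReal_one]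
  rw [tsum_eq_zero_add' ENNReal.summable] at h
  exact h.trans_eq (congrArg (· + _) hone)

theorem CountablySubadditive.toENNReal_E_momentFun_le (hS : S.CountablySubadditive) {Z : Ω → ℝ}
    (hZ : Z ∈ S.H) {r p q : ℝ} (hr : 1 ≤ r) (hp : 0 < p) (hq0 : 0 ≤ q) (hq2 : q ≤ 2)
    (hpq : p * q ≤ r) :
    (S.E fun ω => momentFun q (Z ω)).toENNReal ≤
      1 + ENNReal.ofReal (r * 2 ^ (r - 1)) * ∑' n : ℕ, ENNReal.ofReal (((n : ℝ) + 1) ^ (r - 1)) *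
        ENNReal.ofReal (S.prob {ω | ((n : ℝ) + 1) ^ p < |Z ω|}) := by
  have hA (n : ℕ) : MeasurableSet {ω | ((n : ℝ) + 1) ^ p < |Z ω|} :=
    measurableSet_lt measurable_const (S.measurable_of_mem Z hZ).abs
  have hE (n : ℕ) : (S.E fun ω => r * 2 ^ (r - 1) * ((n : ℝ) + 1) ^ (r - 1) *
      {ω | ((n : ℝ) + 1) ^ p < |Z ω|}.indicator (fun _ => (1 : ℝ)) ω).toENNReal =
      ENNReal.ofReal (r * 2 ^ (r - 1)) * (ENNReal.ofReal (((n : ℝ) + 1) ^ (r - 1)) *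
        ENNReal.ofReal (S.prob {ω | ((n : ℝ) + 1) ^ p < |Z ω|})) := by
    rw [S.pos_homog _ (S.indicator_mem _ (hA n)) _ (by positivity), ← coe_prob (hA n),
      ← EReal.coe_mul, EReal.toENNReal_of_ne_top (EReal.coe_ne_top _), EReal.toReal_coe,
      ENNReal.ofReal_mul (by positivity), ENNReal.ofReal_mul (by positivity), mul_assoc]
  rw [← ENNReal.tsum_mul_left, ← tsum_congr hE]
  exact hS.toENNReal_E_le (momentFun_mem hZ hq0 hq2) (fun _ => momentFun_nonneg _ _)
    (fun n => const_mul_mem _ (S.indicator_mem _ (hA n)))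
    (fun n ω => mul_nonneg (by positivity) (indicator_one_nonneg _ _))
    fun ω => ofReal_momentFun_le hr hp hq0 hpq (Z ω)

theorem prob_lt_abs_eq {X Y : Ω → ℝ} (hX : X ∈ S.H) (hY : Y ∈ S.H) (h : S.IdentDistr X Y)
    (c : ℝ) : S.prob {ω | c < |X ω|} = S.prob {ω | c < |Y ω|} :=
  prob_preimage_eq hX hY h (measurableSet_lt measurable_const measurable_id.abs)

theorem CountablySubadditive.exists_E_momentFun_le (hS : S.CountablySubadditive) {X : Ω → ℝ}
    (hX : X ∈ S.H) {r p q : ℝ} (hr : 1 ≤ r) (hp : 0 < p) (hq0 : 0 ≤ q) (hq2 : q ≤ 2)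
    (hpq : p * q ≤ r)
    (hsum : ∑' n : ℕ, ENNReal.ofReal (((n : ℝ) + 1) ^ (r - 1)) *
      ENNReal.ofReal (S.prob {ω | ((n : ℝ) + 1) ^ p < |X ω|}) < ⊤) :
    ∃ K : ℝ, 0 ≤ K ∧ ∀ Z ∈ S.H, S.IdentDistr Z X → S.E (fun ω => momentFun q (Z ω)) ≤ K := by
  set B := 1 + ENNReal.ofReal (r * 2 ^ (r - 1)) * ∑' n : ℕ,
    ENNReal.ofReal (((n : ℝ) + 1) ^ (r - 1)) *
      ENNReal.ofReal (S.prob {ω | ((n : ℝ) + 1) ^ p < |X ω|})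
  have hB : B ≠ ⊤ := ENNReal.add_ne_top.2
    ⟨ENNReal.one_ne_top, ENNReal.mul_ne_top ENNReal.ofReal_ne_top hsum.ne⟩
  refine ⟨B.toReal, ENNReal.toReal_nonneg, fun Z hZ hZX => ?_⟩
  have hmoment := hS.toENNReal_E_momentFun_le hZ hr hp hq0 hq2 hpq
  simp only [prob_lt_abs_eq hZ hX hZX] at hmoment
  calc S.E (fun ω => momentFun q (Z ω)) ≤ max 0 (S.E fun ω => momentFun q (Z ω)) :=
        le_max_right _ _
    _ = (S.E fun ω => momentFun q (Z ω)).toENNReal := EReal.coe_toENNReal_eq_max.symm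
    _ ≤ (B : EReal) := EReal.coe_ennreal_le_coe_ennreal_iff.2 hmoment
    _ = B.toReal := (EReal.coe_ennreal_toReal hB).symm

end Moments

theorem exists_prob_lt_sum_clamp_le {X : ℕ → Ω → ℝ} (hX : ∀ i, X i ∈ S.H)
    (hind : S.IndepSeq X) {q K : ℝ} (hq0 : 0 ≤ q) (hq2 : q ≤ 2) (hK0 : 0 ≤ K)
    (hK : ∀ i, S.E (fun ω => momentFun q (X i ω)) ≤ K)
    (hmean : ∀ (c : ℝ) (i : ℕ), 1 ≤ i → S.E (fun ω => c * X i ω) ≤ 0)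
    (C : ℝ) {η ε m : ℝ} (hη : 0 < η) (hε : 0 < ε) (hm : 0 < m) :
    ∃ δ M : ℝ, 0 < δ ∧ 0 ≤ M ∧ ∀ (n : ℕ) (a : ℕ → ℝ),
      ∑ i ∈ Finset.range (n + 1), |a i| ^ q ≤ C * ((n : ℝ) + 1) ^ (-η) → ∀ j ≤ n,
        S.prob {ω | ε < ∑ i ∈ Finset.range (j + 1), clamp δ (a i * X i ω)} ≤
          M * ((n : ℝ) + 1) ^ (-m) := by
  set κ : ℝ := 2 * m / ε
  have hκ0 : 0 < κ := by positivity
  have hκε : κ * ε = 2 * m := div_mul_cancel₀ _ hε.ne'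
  set δ : ℝ := min m (η / 2) / κ
  have hδ0 : 0 < δ := by positivity
  have hκδ : κ * δ = min m (η / 2) := mul_div_cancel₀ _ hκ0.ne'
  obtain ⟨M, hM0, hM⟩ := exists_clampConst_mul_log_le (q := q) hδ0.le hκ0.le
    (hκδ.trans_lt ((min_le_right _ _).trans_lt (half_lt_self hη)))
  refine ⟨δ, Real.exp (M * K * C), hδ0, (Real.exp_pos _).le, fun n a ha j hj => ?_⟩
  set x : ℝ := (n : ℝ) + 1
  have hx1 : 1 ≤ x := le_add_of_nonneg_left n.cast_nonneg
  have hx0 : 0 < x := one_pos.trans_le hx1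
  have ht : 0 ≤ κ * Real.log x := mul_nonneg hκ0.le (Real.log_nonneg hx1)
  have hexp : Real.exp (-(κ * Real.log x * ε)) * Real.exp (κ * Real.log x * δ) ≤ x ^ (-m) := by
    rw [← Real.exp_add, Real.rpow_def_of_pos hx0]
    refine Real.exp_le_exp.2 ?_
    have := mul_le_mul_of_nonneg_right (hκδ.trans_le (min_le_left _ _)) (Real.log_nonneg hx1)
    linear_combination this - Real.log x * hκε
  have hsum : ∑ i ∈ Finset.range (j + 1), |a i| ^ q ≤ C * x ^ (-η) :=
    (Finset.sum_le_sum_of_subset_of_nonneg (Finset.range_mono (Nat.succ_le_succ hj))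
      fun i _ _ => by positivity).trans ha
  have hconst : clampConst q δ (κ * Real.log x) * K *
      ∑ i ∈ Finset.range (j + 1), |a i| ^ q ≤ M * K * C :=
    calc _ ≤ M * x ^ η * K * (C * x ^ (-η)) := by
          have := hM x hx1
          gcongr
      _ = M * K * C * (x ^ η * x ^ (-η)) := by ring
      _ = M * K * C := by rw [← Real.rpow_add hx0, add_neg_cancel, Real.rpow_zero, mul_one]
  calc _ ≤ Real.exp (-(κ * Real.log x * ε)) * (Real.exp (κ * Real.log x * δ) *
        Real.exp (clampConst q δ (κ * Real.log x) * K *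
          ∑ i ∈ Finset.range (j + 1), |a i| ^ q)) :=
        prob_lt_sum_clamp_le hX hind ht hδ0 hq0 hq2 hK0 hK (fun i hi => hmean (a i) i hi) ε j
    _ ≤ x ^ (-m) * Real.exp (M * K * C) := by
        rw [← mul_assoc]
        gcongr
    _ = Real.exp (M * K * C) * x ^ (-m) := mul_comm _ _

section TriangleSum

variable {X : Ω → ℝ} {r p α : ℝ}

theorem triangleSum_eq_tsum_sum (X : Ω → ℝ) (r p α c : ℝ) :
    S.triangleSum X r p α c = ∑' n : ℕ, ENNReal.ofReal (((n : ℝ) + 1) ^ (r - 2)) *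
      ∑ k ∈ Finset.range (n + 1),
        ENNReal.ofReal (S.prob {ω | c * triangleThreshold α (n, k) ^ p < |X ω|}) := by
  rw [triangleSum, ENNReal.tsum_prod']
  refine tsum_congr fun n => ?_
  rw [tsum_eq_sum (s := Finset.range (n + 1)), Finset.mul_sum]
  · refine Finset.sum_congr rfl fun k hk => ?_
    rw [triangleWeight, if_pos (Finset.mem_range_succ_iff.1 hk)]
  · intro k hk
    rw [triangleWeight, if_neg (mt Finset.mem_range_succ_iff.2 hk), zero_mul]

theorem tsum_rpow_sub_one_mul_prob_le_triangleSum (hX : Measurable X) (hp : 0 ≤ p)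
    (hα1 : α ≤ 1) :
    ∑' n : ℕ, ENNReal.ofReal (((n : ℝ) + 1) ^ (r - 1)) *
      ENNReal.ofReal (S.prob {ω | ((n : ℝ) + 1) ^ p < |X ω|}) ≤ S.triangleSum X r p α 1 := by
  rw [triangleSum_eq_tsum_sum]
  refine ENNReal.tsum_le_tsum fun n => ?_
  have hn : (0 : ℝ) < n + 1 := by positivity
  have hthreshold : ∀ k ∈ Finset.range (n + 1), triangleThreshold α (n, k) ≤ n + 1 := fun k hk => by
    have hk : (k : ℝ) ≤ n := by exact_mod_cast Finset.mem_range_succ_iff.1 hk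
    calc ((n : ℝ) + 1) ^ α * ((k : ℝ) + 1) ^ (1 - α)
        ≤ ((n : ℝ) + 1) ^ α * ((n : ℝ) + 1) ^ (1 - α) := by
          gcongr
      _ = n + 1 := by rw [← Real.rpow_add hn, add_sub_cancel, Real.rpow_one]
  calc _ = ENNReal.ofReal (((n : ℝ) + 1) ^ (r - 2)) * ∑ _k ∈ Finset.range (n + 1),
        ENNReal.ofReal (S.prob {ω | ((n : ℝ) + 1) ^ p < |X ω|}) := by
        rw [Finset.sum_const, Finset.card_range, nsmul_eq_mul, ← ENNReal.ofReal_natCast,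
          Nat.cast_add_one, show r - 1 = r - 2 + 1 by ring, Real.rpow_add_one hn.ne',
          ENNReal.ofReal_mul (by positivity), mul_assoc]
    _ ≤ _ := by
        gcongr with k hk
        refine prob_lt_antitone hX.abs ?_
        rw [one_mul]
        exact Real.rpow_le_rpow (by unfold triangleThreshold; positivity) (hthreshold k hk) hp

end TriangleSum

end SublinearExpectationSpace

theorem exists_sum_triangleThreshold_rpow_neg_le {α s : ℝ} (hα : 0 < α) (hs : 1 < s) :
    ∃ C η : ℝ, 0 < η ∧ ∀ n : ℕ,
      ∑ k ∈ Finset.range (n + 1), triangleThreshold α (n, k) ^ (-s) ≤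
        C * ((n : ℝ) + 1) ^ (-η) := by
  -- `(1 - α) * s`, lowered below `1` so that the sum over `k` is governed by its last term
  obtain ⟨θ, hθ1, hθle, hθ⟩ : ∃ θ : ℝ, θ < 1 ∧ θ ≤ (1 - α) * s ∧ 1 < α * s + θ := by
    have hαs : 0 < α * s := by positivity
    rcases lt_or_ge ((1 - α) * s) 1 with h | h
    · exact ⟨(1 - α) * s, h, le_rfl, by linarith⟩
    · exact ⟨1 - α * s / 2, by linarith, by linarith, by linarith⟩
  obtain ⟨C, -, hsum⟩ := exists_sum_rpow_sub_one_le (sub_pos.2 hθ1)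
  refine ⟨C, α * s + θ - 1, by linarith, fun n => ?_⟩
  have hn : (0 : ℝ) < n + 1 := by positivity
  have hterm (k : ℕ) : triangleThreshold α (n, k) ^ (-s) ≤
      ((n : ℝ) + 1) ^ (-(α * s)) * ((k : ℝ) + 1) ^ (1 - θ - 1) := by
    rw [triangleThreshold, Real.mul_rpow (by positivity) (by positivity),
      ← Real.rpow_mul (by positivity), ← Real.rpow_mul (by positivity), mul_neg]
    gcongr
    · exact le_add_of_nonneg_left k.cast_nonneg
    · linarith
  calc ∑ k ∈ Finset.range (n + 1), triangleThreshold α (n, k) ^ (-s)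
      ≤ ((n : ℝ) + 1) ^ (-(α * s)) * ∑ k ∈ Finset.range (n + 1), ((k : ℝ) + 1) ^ (1 - θ - 1) := by
        rw [Finset.mul_sum]
        exact Finset.sum_le_sum fun k _ => hterm k
    _ ≤ ((n : ℝ) + 1) ^ (-(α * s)) * (C * ((n : ℝ) + 1) ^ (1 - θ)) := by
        gcongr
        exact_mod_cast hsum (n + 1)
    _ = C * ((n : ℝ) + 1) ^ (-(α * s + θ - 1)) := by
        rw [mul_left_comm, ← Real.rpow_add hn]
        ring_nf

/-! ### Upper bound for maximal partial sums -/

section MaxPartialSum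

variable {Ω : Type*} {a : ℕ → ℝ} {X : ℕ → Ω → ℝ} {n : ℕ} {ω : Ω}

/-- The maximum over `j ≤ n` of the absolute values of the partial sums `∑ i ≤ j, a i * X i`, in
the indexing of the maximal function of the theorem. -/
noncomputable def maxPartialSum (a : ℕ → ℝ) (X : ℕ → Ω → ℝ) (n : ℕ) (ω : Ω) : ℝ :=
  (Finset.range (n + 1)).sup' Finset.nonempty_range_add_one fun j =>
    |∑ i ∈ Finset.range (j + 1), a i * X i ω|

theorem lt_maxPartialSum_iff {c : ℝ} : c < maxPartialSum a X n ω ↔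
    ∃ j ∈ Finset.range (n + 1), c < |∑ i ∈ Finset.range (j + 1), a i * X i ω| :=
  Finset.lt_sup'_iff _

theorem abs_sum_le_maxPartialSum {j : ℕ} (hj : j ≤ n) :
    |∑ i ∈ Finset.range (j + 1), a i * X i ω| ≤ maxPartialSum a X n ω :=
  Finset.le_sup' (fun j => |∑ i ∈ Finset.range (j + 1), a i * X i ω|)
    (Finset.mem_range_succ_iff.2 hj)

theorem maxPartialSum_nonneg : 0 ≤ maxPartialSum a X n ω :=
  (abs_nonneg _).trans (abs_sum_le_maxPartialSum n.zero_le)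

theorem mul_lt_maxPartialSum_iff {ε N : ℝ} (hN : 0 < N) :
    ε * N < maxPartialSum a X n ω ↔ ε < maxPartialSum (fun i => a i / N) X n ω := by
  simp only [lt_maxPartialSum_iff, div_mul_eq_mul_div, ← Finset.sum_div, abs_div, abs_of_pos hN,
    lt_div_iff₀ hN]

theorem abs_mul_le_two_mul_maxPartialSum {i : ℕ} (hi : i ≤ n) :
    |a i * X i ω| ≤ 2 * maxPartialSum a X n ω := by
  have hprev : |∑ k ∈ Finset.range i, a k * X k ω| ≤ maxPartialSum a X n ω := by
    cases i with
    | zero => simpa using maxPartialSum_nonneg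
    | succ i => exact abs_sum_le_maxPartialSum (Nat.le_of_succ_le hi)
  calc |a i * X i ω|
      = |∑ k ∈ Finset.range (i + 1), a k * X k ω - ∑ k ∈ Finset.range i, a k * X k ω| := by
        rw [Finset.sum_range_succ, add_sub_cancel_left]
    _ ≤ |∑ k ∈ Finset.range (i + 1), a k * X k ω| + |∑ k ∈ Finset.range i, a k * X k ω| :=
        abs_sub _ _
    _ ≤ maxPartialSum a X n ω + maxPartialSum a X n ω :=
        add_le_add (abs_sum_le_maxPartialSum hi) hprev
    _ = 2 * maxPartialSum a X n ω := (two_mul _).symm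

theorem lt_sum_clamp_of_lt_maxPartialSum {ε δ : ℝ} (hlt : ε < maxPartialSum a X n ω)
    (hsmall : ∀ i ≤ n, |a i * X i ω| ≤ δ) :
    ∃ j ∈ Finset.range (n + 1), ε < ∑ i ∈ Finset.range (j + 1), clamp δ (a i * X i ω) ∨
      ε < ∑ i ∈ Finset.range (j + 1), clamp δ (-a i * X i ω) := by
  obtain ⟨j, hj, hlt⟩ := lt_maxPartialSum_iff.1 hlt
  have hle : ∀ i ∈ Finset.range (j + 1), |a i * X i ω| ≤ δ := fun i hi =>
    hsmall i ((Finset.mem_range_succ_iff.1 hi).trans (Finset.mem_range_succ_iff.1 hj))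
  have hpos := Finset.sum_congr rfl fun i hi => clamp_of_abs_le (hle i hi)
  have hneg := Finset.sum_congr rfl fun i hi =>
    clamp_of_abs_le ((abs_neg (a i * X i ω)).trans_le (hle i hi))
  rw [Finset.sum_neg_distrib] at hneg
  simp only [neg_mul]
  exact ⟨j, hj, (lt_abs.1 hlt).imp (·.trans_eq hpos.symm) (·.trans_eq hneg.symm)⟩

end MaxPartialSum

namespace SublinearExpectationSpace

variable {Ω : Type*} [MeasurableSpace Ω] {S : SublinearExpectationSpace Ω} {X : ℕ → Ω → ℝ}

theorem measurableSet_lt_maxPartialSum (hX : ∀ i, X i ∈ S.H) (ε : ℝ) (a : ℕ → ℝ) (n : ℕ) :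
    MeasurableSet {ω | ε < maxPartialSum a X n ω} :=
  measurableSet_lt measurable_const <| Finset.measurable_range_sup'' fun _ _ =>
    (Finset.measurable_sum _ fun i _ => (S.measurable_of_mem _ (hX i)).const_mul _).abs

theorem prob_lt_maxPartialSum_le (hX : ∀ i, X i ∈ S.H) (ε δ : ℝ) (a : ℕ → ℝ) (n : ℕ) :
    S.prob {ω | ε < maxPartialSum a X n ω} ≤ ∑ i ∈ Finset.range (n + 1),
      (S.prob {ω | δ < |a i * X i ω|} +
        (S.prob {ω | ε < ∑ k ∈ Finset.range (i + 1), clamp δ (a k * X k ω)} +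
          S.prob {ω | ε < ∑ k ∈ Finset.range (i + 1), clamp δ (-a k * X k ω)})) := by
  have hXm (i : ℕ) : Measurable (X i) := S.measurable_of_mem _ (hX i)
  have hlarge (i : ℕ) : MeasurableSet {ω | δ < |a i * X i ω|} :=
    measurableSet_lt measurable_const ((hXm i).const_mul _).abs
  have hclamp (b : ℕ → ℝ) (j : ℕ) :
      MeasurableSet {ω | ε < ∑ k ∈ Finset.range (j + 1), clamp δ (b k * X k ω)} :=
    measurableSet_lt measurable_const <| Finset.measurable_sum _ fun k _ =>
      (lipschitzWith_clamp δ).continuous.measurable.comp ((hXm k).const_mul _)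
  have hevent (i : ℕ) := (hlarge i).union ((hclamp a i).union (hclamp (fun k => -a k) i))
  refine (prob_mono (measurableSet_lt_maxPartialSum hX ε a n)
    (Finset.measurableSet_biUnion (Finset.range (n + 1)) fun i _ => hevent i)
    fun ω (hω : ε < maxPartialSum a X n ω) => ?_).trans
    ((prob_biUnion_le _ hevent).trans (Finset.sum_le_sum fun i _ => ?_))
  · by_cases hsmall : ∀ i ≤ n, |a i * X i ω| ≤ δ
    · obtain ⟨j, hj, h⟩ := lt_sum_clamp_of_lt_maxPartialSum hω hsmall
      exact Set.mem_biUnion hj (Or.inr h)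
    · push Not at hsmall
      obtain ⟨i, hi, h⟩ := hsmall
      exact Set.mem_biUnion (Finset.mem_range_succ_iff.2 hi) (Or.inl h)
  · exact (prob_union_le (hlarge i) ((hclamp a i).union (hclamp _ i))).trans
      (add_le_add_right (prob_union_le (hclamp a i) (hclamp _ i)) _)

theorem E_const_mul_nonpos {Z : Ω → ℝ} (hZ : Z ∈ S.H) (h : S.E Z ≤ 0)
    (hneg : S.E (fun ω => -Z ω) ≤ 0) (c : ℝ) : S.E (fun ω => c * Z ω) ≤ 0 := by
  rcases le_total 0 c with hc | hc
  · simpa using E_const_mul_le hZ hc (a := 0) h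
  · have hnegZ : (fun ω => -Z ω) ∈ S.H := by simpa using const_mul_mem (-1) hZ
    simpa using E_const_mul_le hnegZ (neg_nonneg.2 hc) (a := 0) hneg

end SublinearExpectationSpace

theorem triangleThreshold_pos (α : ℝ) (i : ℕ × ℕ) : 0 < triangleThreshold α i := by
  unfold triangleThreshold
  positivity

theorem sum_abs_rpow_le_of_mul_triangleThreshold_le {a : ℕ → ℝ} {n : ℕ} {α p q C : ℝ}
    (hq : 0 ≤ q) (ha : ∀ i ≤ n, |a i| * triangleThreshold α (n, n - i) ^ p ≤ C) :
    ∑ i ∈ Finset.range (n + 1), |a i| ^ q ≤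
      C ^ q * ∑ k ∈ Finset.range (n + 1), triangleThreshold α (n, k) ^ (-(p * q)) := by
  rw [← Finset.sum_flip fun k => triangleThreshold α (n, k) ^ (-(p * q)), Finset.mul_sum]
  refine Finset.sum_le_sum fun i hi => ?_
  have hτ := triangleThreshold_pos α (n, n - i)
  have hbound := ha i (Finset.mem_range_succ_iff.1 hi)
  have hC : 0 ≤ C := le_trans (by positivity) hbound
  calc |a i| ^ q ≤ (C / triangleThreshold α (n, n - i) ^ p) ^ q := by
        gcongr
        exact (le_div_iff₀ (by positivity)).2 hbound
    _ = C ^ q * triangleThreshold α (n, n - i) ^ (-(p * q)) := by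
        rw [Real.div_rpow hC (by positivity), ← Real.rpow_mul hτ.le, Real.rpow_neg hτ.le,
          div_eq_mul_inv]

namespace SublinearExpectationSpace

variable {Ω : Type*} [MeasurableSpace Ω] {S : SublinearExpectationSpace Ω} {X : ℕ → Ω → ℝ}
  {Z : Ω → ℝ} {α p C : ℝ}

theorem sum_prob_lt_abs_mul_le (hX : ∀ i, X i ∈ S.H) (hZ : Z ∈ S.H)
    (hident : ∀ i, S.IdentDistr (X i) Z) {a : ℕ → ℝ} {n : ℕ} (hC : 0 < C)
    (ha : ∀ i ≤ n, |a i| * triangleThreshold α (n, n - i) ^ p ≤ C) (δ : ℝ) :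
    ∑ i ∈ Finset.range (n + 1), S.prob {ω | δ < |a i * X i ω|} ≤
      ∑ k ∈ Finset.range (n + 1), S.prob {ω | δ / C * triangleThreshold α (n, k) ^ p < |Z ω|} := by
  rw [← Finset.sum_flip fun k => S.prob {ω | δ / C * triangleThreshold α (n, k) ^ p < |Z ω|}]
  refine Finset.sum_le_sum fun i hi => ?_
  have hXm := S.measurable_of_mem _ (hX i)
  have hτ := Real.rpow_pos_of_pos (triangleThreshold_pos α (n, n - i)) p
  rw [← prob_lt_abs_eq (hX i) hZ (hident i)]
  refine prob_mono (measurableSet_lt measurable_const (hXm.const_mul _).abs)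
    (measurableSet_lt measurable_const hXm.abs) fun ω (hω : δ < |a i * X i ω|) => ?_
  rw [Set.mem_ofPred_eq, div_mul_eq_mul_div, div_lt_iff₀ hC]
  calc δ * triangleThreshold α (n, n - i) ^ p
      < |a i * X i ω| * triangleThreshold α (n, n - i) ^ p := by gcongr
    _ = |X i ω| * (|a i| * triangleThreshold α (n, n - i) ^ p) := by rw [abs_mul]; ring
    _ ≤ |X i ω| * C := by
        gcongr
        exact ha i (Finset.mem_range_succ_iff.1 hi)

theorem exists_prob_lt_maxPartialSum_le (hX : ∀ i, X i ∈ S.H) (hind : S.IndepSeq X) {q K : ℝ}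
    (hq0 : 0 ≤ q) (hq2 : q ≤ 2) (hpq : 1 < p * q) (hK0 : 0 ≤ K)
    (hK : ∀ i, S.E (fun ω => momentFun q (X i ω)) ≤ K)
    (hmean : ∀ (c : ℝ) (i : ℕ), 1 ≤ i → S.E (fun ω => c * X i ω) ≤ 0) (hα : 0 < α)
    {a : ℕ → ℕ → ℝ} (ha : ∀ n, ∀ i ≤ n, |a n i| * triangleThreshold α (n, n - i) ^ p ≤ C)
    {ε m : ℝ} (hε : 0 < ε) (hm : 0 ≤ m) :
    ∃ δ M : ℝ, 0 < δ ∧ 0 ≤ M ∧ ∀ n : ℕ, S.prob {ω | ε < maxPartialSum (a n) X n ω} ≤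
      ∑ i ∈ Finset.range (n + 1), S.prob {ω | δ < |a n i * X i ω|} +
        M * ((n : ℝ) + 1) ^ (-m) := by
  obtain ⟨D, η, hη, hD⟩ := exists_sum_triangleThreshold_rpow_neg_le hα hpq
  obtain ⟨δ, M, hδ, hM, htail⟩ := exists_prob_lt_sum_clamp_le hX hind hq0 hq2 hK0 hK hmean
    (C ^ q * D) hη hε (show 0 < m + 1 by linarith)
  refine ⟨δ, 2 * M, hδ, by positivity, fun n => ?_⟩
  have hn : (0 : ℝ) < n + 1 := by positivity
  have hC : 0 ≤ C := le_trans
    (mul_nonneg (abs_nonneg _) (Real.rpow_nonneg (triangleThreshold_pos α _).le _)) (ha 0 0 le_rfl)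
  have hvariance : ∑ i ∈ Finset.range (n + 1), |a n i| ^ q ≤
      C ^ q * D * ((n : ℝ) + 1) ^ (-η) := by
    rw [mul_assoc]
    refine (sum_abs_rpow_le_of_mul_triangleThreshold_le hq0 (ha n)).trans ?_
    gcongr
    exact hD n
  refine (prob_lt_maxPartialSum_le hX ε δ (a n) n).trans ?_
  rw [Finset.sum_add_distrib]
  refine add_le_add_right ?_ _
  calc _ ≤ ∑ _j ∈ Finset.range (n + 1),
        (M * ((n : ℝ) + 1) ^ (-(m + 1)) + M * ((n : ℝ) + 1) ^ (-(m + 1))) := by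
        refine Finset.sum_le_sum fun j hj => ?_
        have hj := Finset.mem_range_succ_iff.1 hj
        exact add_le_add (htail n (a n) hvariance j hj)
          (htail n (fun i => -a n i) (by simpa only [abs_neg] using hvariance) j hj)
    _ = 2 * M * (((n : ℝ) + 1) ^ (-(m + 1)) * ((n : ℝ) + 1)) := by
        rw [Finset.sum_const, Finset.card_range, nsmul_eq_mul, Nat.cast_add_one]
        ring
    _ = 2 * M * ((n : ℝ) + 1) ^ (-m) := by
        rw [← Real.rpow_add_one hn.ne', neg_add, neg_add_cancel_right]

theorem tsum_rpow_sub_two_mul_lt_top_of_le (hZ : Measurable Z) {r c M : ℝ} (hM : 0 ≤ M)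
    (hfin : S.triangleSum Z r p α c < ⊤) {v : ℕ → ℝ≥0∞}
    (hv : ∀ n, v n ≤ ENNReal.ofReal (∑ k ∈ Finset.range (n + 1),
      S.prob {ω | c * triangleThreshold α (n, k) ^ p < |Z ω|} + M * ((n : ℝ) + 1) ^ (-r))) :
    ∑' n : ℕ, ENNReal.ofReal (((n : ℝ) + 1) ^ (r - 2)) * v n < ⊤ := by
  have hprob (n k : ℕ) : 0 ≤ S.prob {ω | c * triangleThreshold α (n, k) ^ p < |Z ω|} :=
    prob_nonneg (measurableSet_lt measurable_const hZ.abs)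
  have hterm (n : ℕ) : ENNReal.ofReal (((n : ℝ) + 1) ^ (r - 2)) * v n ≤
      ENNReal.ofReal (((n : ℝ) + 1) ^ (r - 2)) * ∑ k ∈ Finset.range (n + 1),
        ENNReal.ofReal (S.prob {ω | c * triangleThreshold α (n, k) ^ p < |Z ω|}) +
      ENNReal.ofReal (M * ((n : ℝ) + 1) ^ (-2 : ℝ)) := by
    have hn : (0 : ℝ) < n + 1 := by positivity
    rw [show (-2 : ℝ) = r - 2 + -r by ring, Real.rpow_add hn, mul_left_comm,
      ENNReal.ofReal_mul (by positivity), ← mul_add,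
      ← ENNReal.ofReal_sum_of_nonneg fun k _ => hprob n k,
      ← ENNReal.ofReal_add (Finset.sum_nonneg fun k _ => hprob n k) (by positivity)]
    gcongr
    exact hv n
  have hsummable : Summable fun n : ℕ => M * ((n : ℝ) + 1) ^ (-2 : ℝ) := by
    have hshift := (summable_nat_add_iff 1).2
      (Real.summable_nat_rpow.2 (show (-2 : ℝ) < -1 by norm_num))
    simp only [Nat.cast_add_one] at hshift
    exact hshift.mul_left M
  refine (ENNReal.tsum_le_tsum hterm).trans_lt ?_
  rw [ENNReal.tsum_add, ← triangleSum_eq_tsum_sum]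
  exact ENNReal.add_lt_top.2 ⟨hfin, hsummable.tsum_ofReal_lt_top⟩

theorem CountablySubadditive.tsum_capacity_maxPartialSum_lt_top (hS : S.CountablySubadditive)
    (hX : ∀ i, X i ∈ S.H) (hind : S.IndepSeq X) (hZ : Z ∈ S.H)
    (hident : ∀ i, S.IdentDistr (X i) Z)
    (hmean : ∀ (c : ℝ) (i : ℕ), 1 ≤ i → S.E (fun ω => c * X i ω) ≤ 0) {r : ℝ} (hr : 1 < r)
    (hp : 1 / 2 < p) (hα0 : 0 < α) (hα1 : α ≤ 1) (hfin : ∀ c > 0, S.triangleSum Z r p α c < ⊤)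
    {a : ℕ → ℕ → ℝ} (hC : 0 < C)
    (ha : ∀ n, ∀ i ≤ n, |a n i| * triangleThreshold α (n, n - i) ^ p ≤ C) {ε : ℝ} (hε : 0 < ε) :
    ∑' n : ℕ, ENNReal.ofReal (((n : ℝ) + 1) ^ (r - 2)) *
      S.capacity {ω | ε < maxPartialSum (a n) X n ω} < ⊤ := by
  have hp0 : 0 < p := one_half_pos.trans hp
  have hZm := S.measurable_of_mem _ hZ
  -- `q` is the largest exponent for which both the moment and the quadratic bounds apply
  set q := min (r / p) 2
  have hq0 : 0 ≤ q := by positivity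
  have hq2 : q ≤ 2 := min_le_right _ _
  have hpq : p * q = min r (p * 2) := by
    rw [mul_min_of_nonneg _ _ hp0.le, mul_div_cancel₀ _ hp0.ne']
  obtain ⟨K, hK0, hK⟩ := hS.exists_E_momentFun_le hZ hr.le hp0 hq0 hq2
    (hpq.trans_le (min_le_left _ _))
    ((tsum_rpow_sub_one_mul_prob_le_triangleSum hZm hp0.le hα1).trans_lt (hfin 1 one_pos))
  obtain ⟨δ, M, hδ, hM, htail⟩ := exists_prob_lt_maxPartialSum_le hX hind hq0 hq2
    (hpq ▸ lt_min hr (by linarith)) hK0 (fun i => hK _ (hX i) (hident i)) hmean hα0 ha hε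
    (zero_le_one.trans hr.le)
  refine tsum_rpow_sub_two_mul_lt_top_of_le hZm hM (hfin (δ / C) (div_pos hδ hC)) fun n => ?_
  rw [capacity_eq_ofReal_prob (measurableSet_lt_maxPartialSum hX ε (a n) n)]
  exact ENNReal.ofReal_le_ofReal ((htail n).trans
    (add_le_add_left (sum_prob_lt_abs_mul_le hX hZ hident hC (ha n) δ) _))

end SublinearExpectationSpace

/-! ### Lower bound for maximal partial sums -/

theorem sum_range_two_mul_le {f g : ℕ → ℝ} (hfg : ∀ k l, l ≤ k → f k ≤ g l) (n : ℕ) :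
    ∑ k ∈ Finset.range (2 * n), f k ≤ 2 * ∑ k ∈ Finset.range n, g k := by
  induction n with
  | zero => simp
  | succ n ih =>
    rw [mul_add_one, Finset.sum_range_succ, Finset.sum_range_succ, Finset.sum_range_succ]
    linarith [hfg (2 * n) n (by lia), hfg (2 * n + 1) n (by lia)]

theorem triangleThreshold_mono {α : ℝ} (hα0 : 0 ≤ α) (hα1 : α ≤ 1) :
    Monotone (triangleThreshold α) := fun _ _ hij =>
  mul_le_mul (Real.rpow_le_rpow (by positivity) (by gcongr; exact hij.1) hα0)
    (Real.rpow_le_rpow (by positivity) (by gcongr; exact hij.2) (sub_nonneg.2 hα1))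
    (by positivity) (by positivity)

theorem tendsto_sum_Ico_div_two {f : ℕ → ℝ} (hf : Summable f) :
    Filter.Tendsto (fun m => ∑ n ∈ Finset.Ico (m / 2) m, f n) Filter.atTop (nhds 0) := by
  have hpartial := hf.hasSum.tendsto_sum_nat
  have hdiff := hpartial.sub (hpartial.comp (Nat.tendsto_div_const_atTop two_ne_zero))
  rw [sub_self] at hdiff
  refine hdiff.congr fun m => ?_
  rw [Finset.sum_Ico_eq_sub _ (Nat.div_le_self m 2), Function.comp_apply]

theorem eventually_lt_one_of_summable_mul_min {r : ℝ} (hr : 1 ≤ r) {s : ℕ → ℝ}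
    (hs : ∀ n m, n ≤ m → m ≤ 2 * n + 1 → s m ≤ 2 * s n)
    (hsum : Summable fun n : ℕ => ((n : ℝ) + 1) ^ (r - 2) * min (s n) 1) :
    ∀ᶠ m in Filter.atTop, s m < 1 := by
  obtain ⟨c, hc, hblock⟩ := exists_le_sum_Ico_rpow_sub_one (r - 1)
  filter_upwards [(tendsto_sum_Ico_div_two hsum).eventually_lt_const (half_pos hc),
    Filter.eventually_ge_atTop 4] with m hsmall hm
  by_contra! hsm
  have hm4 : (4 : ℝ) ≤ m := mod_cast hm
  have hfloor : ⌊(m : ℝ) / 2⌋₊ = m / 2 := mod_cast Nat.floor_div_eq_div (K := ℝ) m 2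
  have hlarge : ∀ n ∈ Finset.Ico (m / 2) m, 1 / 2 ≤ min (s n) 1 := fun n hn => by
    obtain ⟨hmn, hnm⟩ := Finset.mem_Ico.1 hn
    exact le_min (by linarith [hs n m hnm.le (by lia)]) (by norm_num)
  refine hsmall.not_ge ?_
  calc c / 2 ≤ c * (m : ℝ) ^ (r - 1) * (1 / 2) := by
        rw [mul_one_div]
        gcongr
        exact le_mul_of_one_le_right hc.le (Real.one_le_rpow (by linarith) (by linarith))
    _ ≤ (∑ n ∈ Finset.Ico (m / 2) m, ((n : ℝ) + 1) ^ (r - 1 - 1)) * (1 / 2) := by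
        have hblock := hblock m hm4
        rw [hfloor, Nat.floor_natCast] at hblock
        gcongr
    _ ≤ ∑ n ∈ Finset.Ico (m / 2) m, ((n : ℝ) + 1) ^ (r - 2) * min (s n) 1 := by
        rw [Finset.sum_mul, show r - 1 - 1 = r - 2 by ring]
        gcongr with n hn
        exact hlarge n hn

theorem tsum_ofReal_mul_lt_top_of_mul_min {r : ℝ} (hr : 1 ≤ r) {s : ℕ → ℝ} (hs0 : ∀ n, 0 ≤ s n)
    (hs : ∀ n m, n ≤ m → m ≤ 2 * n + 1 → s m ≤ 2 * s n)
    (h : ∑' n : ℕ, ENNReal.ofReal (((n : ℝ) + 1) ^ (r - 2) * min (s n) 1) < ⊤) :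
    ∑' n : ℕ, ENNReal.ofReal (((n : ℝ) + 1) ^ (r - 2) * s n) < ⊤ := by
  have hmin : Summable fun n : ℕ => ((n : ℝ) + 1) ^ (r - 2) * min (s n) 1 := by
    refine (ENNReal.summable_toReal h.ne).congr fun n => ENNReal.toReal_ofReal ?_
    exact mul_nonneg (by positivity) (le_min (hs0 n) zero_le_one)
  refine Summable.tsum_ofReal_lt_top ((summable_congr_atTop ?_).1 hmin)
  filter_upwards [eventually_lt_one_of_summable_mul_min hr hs hmin] with n hn
  rw [min_eq_left hn.le]

theorem min_one_le_two_mul_one_sub_exp_neg {s : ℝ} (hs : 0 ≤ s) :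
    min s 1 ≤ 2 * (1 - Real.exp (-s)) := by
  set m := min s 1
  have hm0 : 0 ≤ m := le_min hs zero_le_one
  have hm1 : m ≤ 1 := min_le_right s 1
  have hexp : Real.exp (-s) ≤ (1 + m)⁻¹ := by
    rw [Real.exp_neg]
    gcongr
    linarith [Real.add_one_le_exp s, min_le_left s 1]
  have hinv : (1 + m)⁻¹ ≤ 1 - m / 2 := by
    rw [inv_le_iff_one_le_mul₀ (by positivity)]
    nlinarith
  linarith

namespace SublinearExpectationSpace

variable {Ω : Type*} [MeasurableSpace Ω] {S : SublinearExpectationSpace Ω} {X : ℕ → Ω → ℝ}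
  {Z : Ω → ℝ} {α p c : ℝ}

theorem IndepSeq.min_sum_prob_le (hind : S.IndepSeq X) (hX : ∀ i, X i ∈ S.H) {B : ℕ → Set ℝ}
    (hB : ∀ i, MeasurableSet (B i)) (n : ℕ) :
    min (∑ i ∈ Finset.range (n + 1), S.prob (X i ⁻¹' B i)) 1 ≤
      2 * S.prob (⋃ i ∈ Finset.range (n + 1), X i ⁻¹' B i) := by
  have hm (i : ℕ) : MeasurableSet (X i ⁻¹' B i) := S.measurable_of_mem _ (hX i) (hB i)
  have hexp : ∏ i ∈ Finset.range (n + 1), (1 - S.prob (X i ⁻¹' B i)) ≤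
      Real.exp (-∑ i ∈ Finset.range (n + 1), S.prob (X i ⁻¹' B i)) := by
    rw [← Finset.sum_neg_distrib, Real.exp_sum]
    exact Finset.prod_le_prod (fun i _ => sub_nonneg.2 (prob_le_one (hm i)))
      fun i _ => Real.one_sub_le_exp_neg _
  rw [← hind.one_sub_prob_biUnion hX hB n] at hexp
  linarith [min_one_le_two_mul_one_sub_exp_neg
    (Finset.sum_nonneg fun i (_ : i ∈ Finset.range (n + 1)) => prob_nonneg (S := S) (hm i))]

theorem sum_prob_lt_abs_le_sum_prob_lt_abs_mul (hX : ∀ i, X i ∈ S.H) (hZ : Z ∈ S.H)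
    (hident : ∀ i, S.IdentDistr (X i) Z) {a : ℕ → ℝ} {n : ℕ} (hc : 0 < c)
    (ha : ∀ i ≤ n, c ≤ |a i| * triangleThreshold α (n, n - i) ^ p) {δ : ℝ} (hδ : 0 ≤ δ) :
    ∑ k ∈ Finset.range (n + 1), S.prob {ω | δ / c * triangleThreshold α (n, k) ^ p < |Z ω|} ≤
      ∑ i ∈ Finset.range (n + 1), S.prob {ω | δ < |a i * X i ω|} := by
  rw [← Finset.sum_flip fun k => S.prob {ω | δ / c * triangleThreshold α (n, k) ^ p < |Z ω|}]
  refine Finset.sum_le_sum fun i hi => ?_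
  have hXm := S.measurable_of_mem _ (hX i)
  have hbound := ha i (Finset.mem_range_succ_iff.1 hi)
  have ha0 : 0 < |a i| := pos_of_mul_pos_left (hc.trans_le hbound)
    (Real.rpow_nonneg (triangleThreshold_pos α _).le _)
  rw [← prob_lt_abs_eq (hX i) hZ (hident i)]
  refine prob_mono (measurableSet_lt measurable_const hXm.abs)
    (measurableSet_lt measurable_const (hXm.const_mul _).abs)
    fun ω (hω : δ / c * triangleThreshold α (n, n - i) ^ p < |X i ω|) => ?_
  calc δ = δ / c * c := (div_mul_cancel₀ δ hc.ne').symm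
    _ ≤ δ / c * (|a i| * triangleThreshold α (n, n - i) ^ p) := by gcongr
    _ = |a i| * (δ / c * triangleThreshold α (n, n - i) ^ p) := by ring
    _ < |a i| * |X i ω| := by gcongr
    _ = |a i * X i ω| := (abs_mul _ _).symm

theorem IndepSeq.min_sum_prob_le_prob_lt_maxPartialSum (hind : S.IndepSeq X)
    (hX : ∀ i, X i ∈ S.H) (a : ℕ → ℝ) (n : ℕ) (ε : ℝ) :
    min (∑ i ∈ Finset.range (n + 1), S.prob {ω | 2 * ε < |a i * X i ω|}) 1 ≤
      2 * S.prob {ω | ε < maxPartialSum a X n ω} := by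
  have hB (i : ℕ) : MeasurableSet {x : ℝ | 2 * ε < |a i * x|} :=
    measurableSet_lt measurable_const (measurable_id.const_mul _).abs
  refine (hind.min_sum_prob_le hX hB n).trans (mul_le_mul_of_nonneg_left ?_ zero_le_two)
  refine prob_mono (Finset.measurableSet_biUnion _ fun i _ => S.measurable_of_mem _ (hX i) (hB i))
    (measurableSet_lt_maxPartialSum hX ε a n) (Set.iUnion₂_subset fun i hi ω hω => ?_)
  exact lt_of_mul_lt_mul_left (hω.trans_le
    (abs_mul_le_two_mul_maxPartialSum (Finset.mem_range_succ_iff.1 hi))) zero_le_two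

theorem sum_prob_lt_abs_le_two_mul (hZ : Measurable Z) (hp : 0 ≤ p) (hα0 : 0 ≤ α) (hα1 : α ≤ 1)
    (hc : 0 ≤ c) {n m : ℕ} (hnm : n ≤ m) (hm : m ≤ 2 * n + 1) :
    ∑ k ∈ Finset.range (m + 1), S.prob {ω | c * triangleThreshold α (m, k) ^ p < |Z ω|} ≤
      2 * ∑ k ∈ Finset.range (n + 1), S.prob {ω | c * triangleThreshold α (n, k) ^ p < |Z ω|} := by
  refine le_trans ?_ (sum_range_two_mul_le (f := fun k =>
    S.prob {ω | c * triangleThreshold α (m, k) ^ p < |Z ω|}) (fun k l hlk => ?_) (n + 1))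
  · exact Finset.sum_le_sum_of_subset_of_nonneg (Finset.range_mono (by lia))
      fun k _ _ => prob_nonneg (measurableSet_lt measurable_const hZ.abs)
  · refine prob_lt_antitone hZ.abs (mul_le_mul_of_nonneg_left ?_ hc)
    exact Real.rpow_le_rpow (triangleThreshold_pos α _).le
      (triangleThreshold_mono hα0 hα1 ⟨hnm, hlk⟩) hp

theorem IndepSeq.triangleSum_lt_top (hind : S.IndepSeq X) (hX : ∀ i, X i ∈ S.H) (hZ : Z ∈ S.H)
    (hident : ∀ i, S.IdentDistr (X i) Z) {r : ℝ} (hr : 1 ≤ r) (hp : 0 ≤ p) (hα0 : 0 ≤ α)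
    (hα1 : α ≤ 1) {a : ℕ → ℕ → ℝ} (hc : 0 < c)
    (ha : ∀ n, ∀ i ≤ n, c ≤ |a n i| * triangleThreshold α (n, n - i) ^ p) {ε : ℝ} (hε : 0 ≤ ε)
    (hfin : ∑' n : ℕ, ENNReal.ofReal (((n : ℝ) + 1) ^ (r - 2)) *
      S.capacity {ω | ε < maxPartialSum (a n) X n ω} < ⊤) :
    S.triangleSum Z r p α (2 * ε / c) < ⊤ := by
  have hZm := S.measurable_of_mem _ hZ
  set s : ℕ → ℝ := fun n => ∑ k ∈ Finset.range (n + 1),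
    S.prob {ω | 2 * ε / c * triangleThreshold α (n, k) ^ p < |Z ω|}
  have hprob (n k : ℕ) : 0 ≤ S.prob {ω | 2 * ε / c * triangleThreshold α (n, k) ^ p < |Z ω|} :=
    prob_nonneg (measurableSet_lt measurable_const hZm.abs)
  have hmin (n : ℕ) : min (s n) 1 ≤ 2 * S.prob {ω | ε < maxPartialSum (a n) X n ω} :=
    (min_le_min_right 1 (sum_prob_lt_abs_le_sum_prob_lt_abs_mul hX hZ hident hc (ha n)
      (by positivity))).trans (hind.min_sum_prob_le_prob_lt_maxPartialSum hX (a n) n ε)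
  have htriangle : S.triangleSum Z r p α (2 * ε / c) =
      ∑' n : ℕ, ENNReal.ofReal (((n : ℝ) + 1) ^ (r - 2) * s n) := by
    rw [triangleSum_eq_tsum_sum]
    refine tsum_congr fun n => ?_
    rw [ENNReal.ofReal_mul (by positivity), ENNReal.ofReal_sum_of_nonneg fun k _ => hprob n k]
  rw [htriangle]
  refine tsum_ofReal_mul_lt_top_of_mul_min hr (fun n => Finset.sum_nonneg fun k _ => hprob n k)
    (fun n m => sum_prob_lt_abs_le_two_mul hZm hp hα0 hα1 (by positivity))
    (lt_of_le_of_lt ?_ (ENNReal.mul_lt_top (ENNReal.ofReal_lt_top (r := 2)) hfin))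
  rw [← ENNReal.tsum_mul_left]
  refine ENNReal.tsum_le_tsum fun n => ?_
  rw [capacity_eq_ofReal_prob (measurableSet_lt_maxPartialSum hX ε (a n) n), mul_left_comm,
    ← ENNReal.ofReal_mul zero_le_two, ← ENNReal.ofReal_mul (by positivity)]
  gcongr
  exact hmin n

end SublinearExpectationSpace

/-! ### Cesàro weights -/

/-- The weight `(A_{n-i}^{α-1} / A_n^α)^p` of `X_i` in the normalized weighted sum; the paper's
`n ≥ 1` is `n + 1` here, so the weight is meaningful for `i ≤ n`. -/
noncomputable def cesaroWeight (α p : ℝ) (n i : ℕ) : ℝ :=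
  (cesaroNumber (α - 1) (n + 1 - i) / cesaroNumber α (n + 1)) ^ p

theorem cesaroNumber_pos {α : ℝ} (hα0 : 0 ≤ α) (hα1 : α ≤ 1) (n : ℕ) :
    0 < cesaroNumber α (n + 1) :=
  lt_of_lt_of_le (by positivity) (rpow_le_cesaroNumber hα0 hα1 n)

theorem cesaroNumber_sub_one_pos {α : ℝ} (hα0 : 0 < α) (hα1 : α ≤ 1) (n : ℕ) :
    0 < cesaroNumber (α - 1) (n + 1) :=
  lt_of_lt_of_le (by positivity) (rpow_le_cesaroNumber_sub_one hα0 hα1 n)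

theorem abs_cesaroWeight_mul_triangleThreshold {α : ℝ} (hα0 : 0 < α) (hα1 : α ≤ 1) (p : ℝ)
    {n i : ℕ} (hi : i ≤ n) :
    |cesaroWeight α p n i| * triangleThreshold α (n, n - i) ^ p =
      (cesaroNumber (α - 1) (n - i + 1) / cesaroNumber α (n + 1) *
        triangleThreshold α (n, n - i)) ^ p := by
  have hratio : 0 ≤ cesaroNumber (α - 1) (n - i + 1) / cesaroNumber α (n + 1) :=
    div_nonneg (cesaroNumber_sub_one_pos hα0 hα1 _).le (cesaroNumber_pos hα0.le hα1 _).le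
  rw [cesaroWeight, Nat.sub_add_comm hi, abs_of_nonneg (Real.rpow_nonneg hratio p),
    Real.mul_rpow hratio (triangleThreshold_pos α _).le]

theorem abs_cesaroWeight_mul_triangleThreshold_le {α p : ℝ} (hα0 : 0 < α) (hα1 : α ≤ 1)
    (hp : 0 ≤ p) {n i : ℕ} (hi : i ≤ n) :
    |cesaroWeight α p n i| * triangleThreshold α (n, n - i) ^ p ≤ Real.exp α ^ p := by
  rw [abs_cesaroWeight_mul_triangleThreshold hα0 hα1 p hi]
  exact Real.rpow_le_rpow ((by positivity : 0 ≤ α / 2 / Real.exp α).trans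
    (le_cesaroNumber_ratio_mul_triangleThreshold hα0 hα1 n (n - i)))
    (cesaroNumber_ratio_mul_triangleThreshold_le hα0 hα1 n (n - i)) hp

theorem le_abs_cesaroWeight_mul_triangleThreshold {α p : ℝ} (hα0 : 0 < α) (hα1 : α ≤ 1)
    (hp : 0 ≤ p) {n i : ℕ} (hi : i ≤ n) :
    (α / 2 / Real.exp α) ^ p ≤ |cesaroWeight α p n i| * triangleThreshold α (n, n - i) ^ p := by
  rw [abs_cesaroWeight_mul_triangleThreshold hα0 hα1 p hi]
  exact Real.rpow_le_rpow (by positivity)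
    (le_cesaroNumber_ratio_mul_triangleThreshold hα0 hα1 n (n - i)) hp

theorem mul_lt_sup'_abs_sum_cesaroNumber_iff {Ω : Type*} {X : ℕ → Ω → ℝ} {α : ℝ} (hα0 : 0 < α)
    (hα1 : α ≤ 1) (p ε : ℝ) (n : ℕ) (ω : Ω) :
    ε * cesaroNumber α (n + 1) ^ p <
        (Finset.range (n + 1)).sup' Finset.nonempty_range_add_one (fun j =>
          |∑ i ∈ Finset.range (j + 1), cesaroNumber (α - 1) (n + 1 - i) ^ p * X i ω|) ↔
      ε < maxPartialSum (cesaroWeight α p n) X n ω := by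
  have hpos := cesaroNumber_pos hα0.le hα1 n
  refine (mul_lt_maxPartialSum_iff (Real.rpow_pos_of_pos hpos p)).trans ?_
  rw [lt_maxPartialSum_iff, lt_maxPartialSum_iff]
  refine exists_congr fun j => and_congr_right fun hj => ?_
  have hweight : ∀ i ∈ Finset.range (j + 1), cesaroNumber (α - 1) (n + 1 - i) ^ p /
      cesaroNumber α (n + 1) ^ p * X i ω = cesaroWeight α p n i * X i ω := fun i hi => by
    have hi : i ≤ n := by grind
    have hnum : 0 ≤ cesaroNumber (α - 1) (n + 1 - i) := by
      rw [Nat.sub_add_comm hi]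
      exact (cesaroNumber_sub_one_pos hα0 hα1 _).le
    rw [cesaroWeight, Real.div_rpow hnum hpos.le]
  rw [Finset.sum_congr rfl hweight]

theorem corollary3p1 {Ω : Type*} [MeasurableSpace Ω] (S : SublinearExpectationSpace Ω)
    (hS : S.CountablySubadditive)
    (X : Ω → ℝ) (hX : X ∈ S.H)
    (Xs : ℕ → Ω → ℝ) (hXs : ∀ n, Xs n ∈ S.H)
    (hindep : S.IndepSeq Xs) (hident : ∀ n, S.IdentDistr (Xs n) X)
    (hmean : ∀ i : ℕ, 1 ≤ i → S.E (Xs i) = 0 ∧ -S.E (fun ω => -Xs i ω) = 0)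
    (r p α : ℝ) (hr : 1 < r) (hp : 1 / 2 < p) (hα0 : 0 < α) (hα1 : α ≤ 1) :
    ((α < 1 - 1 / r → S.choquet (fun ω => |X ω| ^ ((r - 1) / (p * α))) < ⊤) ∧
      (α = 1 - 1 / r → S.choquet (fun ω => |X ω| ^ (r / p) * Real.log (1 + |X ω|)) < ⊤) ∧
      (1 - 1 / r < α → S.choquet (fun ω => |X ω| ^ (r / p)) < ⊤)) ↔
    ∀ ε : ℝ, 0 < ε →
      -- the summation index of the series is `n + 1 = 1, 2, …`
      ∑' n : ℕ, ENNReal.ofReal (((n + 1 : ℕ) : ℝ) ^ (r - 2)) *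
        S.capacity {ω | ε * cesaroNumber α (n + 1) ^ p <
          (Finset.range (n + 1)).sup' Finset.nonempty_range_add_one (fun j =>
            |∑ i ∈ Finset.range (j + 1),
              cesaroNumber (α - 1) (n + 1 - i) ^ p * Xs i ω|)} < ⊤ := by
  have hXm := S.measurable_of_mem X hX
  have hp0 : 0 < p := one_half_pos.trans hp
  simp only [mul_lt_sup'_abs_sum_cesaroNumber_iff hα0 hα1, Nat.cast_add_one]
  constructor
  · intro hC ε hε
    have hmean (c : ℝ) (i : ℕ) (hi : 1 ≤ i) : S.E (fun ω => c * Xs i ω) ≤ 0 :=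
      SublinearExpectationSpace.E_const_mul_nonpos (hXs i) (hmean i hi).1.le
        (EReal.neg_eq_zero_iff.1 (hmean i hi).2).le c
    exact hS.tsum_capacity_maxPartialSum_lt_top hXs hindep hX hident hmean hr hp hα0 hα1
      (fun c hc => (SublinearExpectationSpace.choquet_conditions_iff hXm hr hp0 hα0 hα1 hc).1 hC)
      (Real.rpow_pos_of_pos (Real.exp_pos α) p)
      (fun n i hi => abs_cesaroWeight_mul_triangleThreshold_le hα0 hα1 hp0.le hi) hε
  · intro hfin
    have hc : 0 < (α / 2 / Real.exp α) ^ p := by positivity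
    have htriangle := hindep.triangleSum_lt_top hXs hX hident hr.le hp0.le hα0.le hα1 hc
      (fun n i hi => le_abs_cesaroWeight_mul_triangleThreshold hα0 hα1 hp0.le hi) zero_le_one
      (hfin 1 one_pos)
    exact (SublinearExpectationSpace.choquet_conditions_iff hXm hr hp0 hα0 hα1
      (by positivity)).2 htriangle
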